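/- Let $\mathbb H^d=\mathbb R^d\times\mathbb R^d\times\mathbb R$ be the Heisenberg group with law $(p,q,t)(p',q',t')=(p+p',q+q',t+t'+p\cdot q')$ and Haar measure equal to Lebesgue measure, and let $L_g\psi(x)=\psi(g^{-1}x)$ for $g,x\in\mathbb H^d$ and $\psi\in L^2(\mathbb H^d)$. For $\lambda\in\mathbb R\setminus\{0\}$ let $\Pi_\lambda$ be the Schrödinger representation on $L^2(\mathbb R^d)$, $$\Pi_\lambda(p,q,t)f(y)=e^{2\pi i\lambda t}e^{-2\pi i\lambda q\cdot y}f(y-p),$$ and let $\mathcal F\varphi(\lambda)=\int_{\mathbb H^d}\varphi(x)\Pi_\lambda(x)\,dx$ for $\varphi\in L^1(\mathbb H^d)\cap L^2(\mathbb H^d)$, where the integral is understood weakly. By Plancherel's theorem $\mathcal F$ extends by continuity to $L^2(\mathbb H^d)$, with values in the $L^2$ space of Hilbert–Schmidt operator valued functions of $\lambda$ with respect to $|\lambda|^d\,d\lambda$; so $\mathcal F\varphi(\lambda)$ is defined for a.e. $\lambda$. For $\varphi,\psi\in L^2(\mathbb H^d)$ and a.e. $\alpha\in(0,1]$ put $$[\varphi,\psi](\alpha)=\sum_{j\in\mathbb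 Z}\big\langle\mathcal F\varphi(\alpha+j),\mathcal F\psi(\alpha+j)\big\rangle_{\mathcal{HS}}\,|\alpha+j|^d,\qquad \langle S,T\rangle_{\mathcal{HS}}=\operatorname{trace}(ST^\dagger).$$ Let $A,B\in GL(d,\mathbb R)$ be such that $A^{t}B$ has integer entries, so that $\Gamma=A\mathbb Z^d\times B\mathbb Z^d\times\mathbb Z$ is a subgroup of $\mathbb H^d$, and let $\Gamma_1=A\mathbb Z^d\times B\mathbb Z^d\times\{0\}$. Let $\psi\in L^2(\mathbb H^d)$, $\psi\neq0$. Then the family $\{L_\gamma\psi\}_{\gamma\in\Gamma}$ is an orthonormal basis of the closed linear span of $\{L_\gamma\psi:\gamma\in\Gamma\}$ in $L^2(\mathbb H^d)$ if and only if, for every $\gamma_1\in\Gamma_1$, $$[\psi,L_{\gamma_1}\psi](\alpha)=\delta_{\gamma_1,0}\quad\text{for a.e. }\alpha\in(0,1],$$ where $\delta_{\gamma_1,0}$ is $1$ if $\gamma_1=(0,0,0)$ and $0$ otherwise. -/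

import Mathlib

open MeasureTheory Filter Topology
open scoped ENNReal Matrix

noncomputable section

/-- The Hilbert space `L²(ℝᵈ)` of complex-valued functions. -/
abbrev L2R (d : ℕ) : Type :=
  Lp ℂ 2 (volume : Measure (EuclideanSpace ℝ (Fin d)))

/-- The (polarized) Heisenberg group `ℍᵈ`, with underlying set `ℝᵈ × ℝᵈ × ℝ`, points `(p, q, t)`. -/
def Heis (d : ℕ) : Type :=
  EuclideanSpace ℝ (Fin d) × EuclideanSpace ℝ (Fin d) × ℝ

namespace Heis

variable {d : ℕ}

/-- The point `(p, q, t)`. -/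
def mk (p q : EuclideanSpace ℝ (Fin d)) (t : ℝ) : Heis d := (p, q, t)

/-- The coordinate `p`. -/
def p (x : Heis d) : EuclideanSpace ℝ (Fin d) := x.1

/-- The coordinate `q`. -/
def q (x : Heis d) : EuclideanSpace ℝ (Fin d) := x.2.1

/-- The central coordinate `t`. -/
def t (x : Heis d) : ℝ := x.2.2

@[simp] theorem p_mk (p q : EuclideanSpace ℝ (Fin d)) (t : ℝ) : (mk p q t).p = p := rfl
@[simp] theorem q_mk (p q : EuclideanSpace ℝ (Fin d)) (t : ℝ) : (mk p q t).q = q := rfl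
@[simp] theorem t_mk (p q : EuclideanSpace ℝ (Fin d)) (t : ℝ) : (mk p q t).t = t := rfl

@[ext] theorem ext {x y : Heis d} (hp : x.p = y.p) (hq : x.q = y.q) (ht : x.t = y.t) : x = y :=
  Prod.ext hp (Prod.ext hq ht)

instance : TopologicalSpace (Heis d) :=
  inferInstanceAs
    (TopologicalSpace (EuclideanSpace ℝ (Fin d) × EuclideanSpace ℝ (Fin d) × ℝ))

/-- Lebesgue measure on `ℝᵈ × ℝᵈ × ℝ`, which is the Haar measure. -/
instance : MeasureSpace (Heis d) :=
  inferInstanceAs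
    (MeasureSpace (EuclideanSpace ℝ (Fin d) × EuclideanSpace ℝ (Fin d) × ℝ))

/-- `(p,q,t)(p',q',t') = (p + p', q + q', t + t' + p · q')`. -/
instance : Mul (Heis d) :=
  ⟨fun x y => mk (x.p + y.p) (x.q + y.q) (x.t + y.t + inner ℝ x.p y.q)⟩

instance : One (Heis d) := ⟨mk 0 0 0⟩

/-- `(p,q,t)⁻¹ = (-p, -q, -t + p · q)`. -/
instance : Inv (Heis d) := ⟨fun x => mk (-x.p) (-x.q) (-x.t + inner ℝ x.p x.q)⟩

@[simp] theorem p_mul (x y : Heis d) : (x * y).p = x.p + y.p := rfl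
@[simp] theorem q_mul (x y : Heis d) : (x * y).q = x.q + y.q := rfl
@[simp] theorem t_mul (x y : Heis d) : (x * y).t = x.t + y.t + inner ℝ x.p y.q := rfl
@[simp] theorem p_one : (1 : Heis d).p = 0 := rfl
@[simp] theorem q_one : (1 : Heis d).q = 0 := rfl
@[simp] theorem t_one : (1 : Heis d).t = 0 := rfl
@[simp] theorem p_inv (x : Heis d) : (x⁻¹).p = -x.p := rfl
@[simp] theorem q_inv (x : Heis d) : (x⁻¹).q = -x.q := rfl
@[simp] theorem t_inv (x : Heis d) : (x⁻¹).t = -x.t + inner ℝ x.p x.q := rfl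

instance : Group (Heis d) :=
  Group.ofLeftAxioms
    (fun x y z => by
      ext1
      · simp [add_assoc]
      · simp [add_assoc]
      · simp only [t_mul, p_mul, q_mul, inner_add_left, inner_add_right]; ring)
    (fun x => by ext1 <;> simp)
    (fun x => by ext1 <;> simp)

theorem measurePreserving_mul_left (g : Heis d) :
    MeasurePreserving (fun x : Heis d => g * x) volume volume := by
  have h : MeasurePreserving
      (fun z : EuclideanSpace ℝ (Fin d) × EuclideanSpace ℝ (Fin d) × ℝ =>
        (g.p + z.1, (g.q + z.2.1, g.t + z.2.2 + inner ℝ g.p z.2.1)))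
      (volume.prod (volume.prod volume)) (volume.prod (volume.prod volume)) := by
    have h1 : MeasurePreserving
        (fun w : EuclideanSpace ℝ (Fin d) × ℝ => (g.q + w.1, g.t + w.2 + inner ℝ g.p w.1))
        (volume.prod volume) (volume.prod volume) := by
      refine (measurePreserving_add_left volume g.q).skew_product
        (g := fun q t => g.t + t + inner ℝ g.p q) (by fun_prop) ?_
      refine Eventually.of_forall fun q => ?_
      have h2 := (measurePreserving_add_right (volume : Measure ℝ) (inner ℝ g.p q)).comp
        (measurePreserving_add_left (volume : Measure ℝ) g.t)
      exact h2.map_eq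
    exact (measurePreserving_add_left volume g.p).prod h1
  exact h

end Heis

/-- The Hilbert space `L²(ℍᵈ)`. -/
abbrev L2H (d : ℕ) : Type := Lp ℂ 2 (volume : Measure (Heis d))

/-- Left translation on `L²(ℍᵈ)`: `(L_g ψ)(x) = ψ(g⁻¹ x)`. -/
def leftTranslate {d : ℕ} (g : Heis d) : L2H d →ₗᵢ[ℂ] L2H d :=
  Lp.compMeasurePreservingₗᵢ ℂ (fun x => g⁻¹ * x) (Heis.measurePreserving_mul_left g⁻¹)

/-- The unimodular factor `e^{2πi l t} e^{-2πi l q·y}` of the Schrödinger representation. -/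
def schrodingerPhase {d : ℕ} (l : ℝ) (x : Heis d) (y : EuclideanSpace ℝ (Fin d)) : ℂ :=
  Complex.exp (2 * Real.pi * Complex.I * l * x.t) *
    Complex.exp (-(2 * Real.pi * Complex.I * l * (inner ℝ x.q y : ℝ)))

theorem norm_schrodingerPhase {d : ℕ} (l : ℝ) (x : Heis d) (y : EuclideanSpace ℝ (Fin d)) :
    ‖schrodingerPhase l x y‖ = 1 := by
  simp [schrodingerPhase, Complex.norm_exp]

theorem memLp_schrodinger {d : ℕ} (l : ℝ) (x : Heis d) (f : L2R d) :
    MemLp (fun y => schrodingerPhase l x y * f (y - x.p)) 2 volume := by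
  have h1 : MemLp (fun y => f (y - x.p)) 2 volume :=
    (Lp.memLp f).comp_measurePreserving (measurePreserving_sub_right volume x.p)
  refine h1.of_le ?_ (Eventually.of_forall fun y => by simp [norm_schrodingerPhase])
  refine AEStronglyMeasurable.mul ?_ h1.1
  refine Continuous.aestronglyMeasurable ?_
  unfold schrodingerPhase
  fun_prop

/-- The Schrödinger representation `Π_l` of `ℍᵈ` on `L²(ℝᵈ)`:
`Π_l(p,q,t) f (y) = e^{2πi l t} e^{-2πi l q·y} f(y - p)`. -/
def schrodinger {d : ℕ} (l : ℝ) (x : Heis d) (f : L2R d) : L2R d :=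
  (memLp_schrodinger l x f).toLp

/-- `T = ∫ φ(x) Π_l(x) dx`, the operator-valued integral being taken in the weak sense. This
determines `T`; it is used for integrable `φ`. -/
def IsFourierIntegral {d : ℕ} (φ : L2H d) (l : ℝ) (T : L2R d →L[ℂ] L2R d) : Prop :=
  ∀ f g : L2R d, inner ℂ g (T f) = ∫ x : Heis d, φ x * inner ℂ g (schrodinger l x f)

section HilbertSchmidt

variable {E : Type*} [NormedAddCommGroup E] [InnerProductSpace ℂ E] [CompleteSpace E]

variable (E) in
/-- The index set of a fixed orthonormal basis of the Hilbert space `E`. -/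
def onbSet : Set E := (exists_hilbertBasis ℂ E).choose

variable (E) in
/-- A fixed orthonormal basis of the Hilbert space `E` (the quantities below do not depend on
its choice, on the operators they are meant for). -/
def onb : HilbertBasis (onbSet E) ℂ E := (exists_hilbertBasis ℂ E).choose_spec.choose

/-- The trace of an operator (of trace class). -/
def opTrace (T : E →L[ℂ] E) : ℂ := ∑' i, inner ℂ (onb E i) (T (onb E i))

/-- The Hilbert–Schmidt inner product `trace (S T†)` of two Hilbert–Schmidt operators, linear in
the first argument. -/
def hsInner (S T : E →L[ℂ] E) : ℂ := opTrace (S ∘L ContinuousLinearMap.adjoint T)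

/-- The square of the Hilbert–Schmidt norm, in `[0, ∞]`; it is finite exactly for Hilbert–Schmidt
operators. -/
def hsNormSq (T : E →L[ℂ] E) : ℝ≥0∞ := ∑' i, ‖T (onb E i)‖ₑ ^ 2

end HilbertSchmidt

/-- `F` is (a representative of) the group Fourier transform of `φ ∈ L²(ℍᵈ)`. As usual this is the
extension by continuity of `φ ↦ (l ↦ ∫ φ(x) Π_l(x) dx)` from `L¹ ∩ L²` to `L²`: the measurable
field `F` of operators is a limit, in the Hilbert–Schmidt-valued `L²` space of the
Plancherel measure `|l|ᵈ dl`, of the transforms of some functions `u n ∈ L¹ ∩ L²` that converge to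
`φ` in `L²(ℍᵈ)`. It determines `F` up to a null set of `l`. -/
def IsGroupFourier {d : ℕ} (φ : L2H d) (F : ℝ → L2R d →L[ℂ] L2R d) : Prop :=
  (∀ f g : L2R d, AEMeasurable (fun l => inner ℂ g (F l f)) volume) ∧
  ∃ (u : ℕ → L2H d) (T : ℕ → ℝ → L2R d →L[ℂ] L2R d),
    (∀ n, Integrable (u n) volume) ∧
    (∀ n l, IsFourierIntegral (u n) l (T n l)) ∧
    Tendsto u atTop (𝓝 φ) ∧
    Tendsto (fun n => ∫⁻ l : ℝ, hsNormSq (F l - T n l) * ENNReal.ofReal (|l| ^ d))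
      atTop (𝓝 0)

open Classical in
/-- The group Fourier transform of `φ ∈ L²(ℍᵈ)`, an operator-valued function of `l` that is
well defined up to a null set. (It exists for every `φ` by Plancherel; the value
`0` in the other branch is never used.) -/
def groupFourier {d : ℕ} (φ : L2H d) : ℝ → L2R d →L[ℂ] L2R d :=
  if h : ∃ F, IsGroupFourier φ F then h.choose else 0

/-- The bracket
`[φ, ψ](α) = ∑_{j ∈ ℤ} ⟨ℱφ(α + j), ℱψ(α + j)⟩_HS |α + j|ᵈ`. -/
def bracket {d : ℕ} (φ ψ : L2H d) (α : ℝ) : ℂ :=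
  ∑' j : ℤ, hsInner (groupFourier φ (α + j)) (groupFourier ψ (α + j)) * ((|α + j| ^ d : ℝ) : ℂ)

/-- The vector `A m ∈ ℝᵈ` for an integer vector `m`. -/
def latticeVec {d : ℕ} (A : GL (Fin d) ℝ) (m : Fin d → ℤ) : EuclideanSpace ℝ (Fin d) :=
  WithLp.toLp 2 ((A : Matrix (Fin d) (Fin d) ℝ) *ᵥ fun i => (m i : ℝ))

theorem latticeVec_add {d : ℕ} (A : GL (Fin d) ℝ) (m n : Fin d → ℤ) :
    latticeVec A (m + n) = latticeVec A m + latticeVec A n := by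
  have : (fun i => ((m + n) i : ℝ)) = (fun i => (m i : ℝ)) + fun i => (n i : ℝ) := by
    ext i; simp
  rw [latticeVec, this, Matrix.mulVec_add]; rfl

theorem latticeVec_neg {d : ℕ} (A : GL (Fin d) ℝ) (m : Fin d → ℤ) :
    latticeVec A (-m) = -latticeVec A m := by
  have : (fun i => ((-m) i : ℝ)) = -(fun i => (m i : ℝ)) := by
    ext i; simp
  rw [latticeVec, this, Matrix.mulVec_neg]; rfl

theorem latticeVec_zero {d : ℕ} (A : GL (Fin d) ℝ) : latticeVec A 0 = 0 := by
  have : (fun i => ((0 : Fin d → ℤ) i : ℝ)) = 0 := by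
    ext i; simp
  rw [latticeVec, this, Matrix.mulVec_zero]; rfl

/-- The pairing `(m, n) ↦ A m · B n` is integer valued on `ℤᵈ × ℤᵈ`, that is, the matrix `Aᵀ B`
has integer entries. -/
def IsIntegralPair {d : ℕ} (A B : GL (Fin d) ℝ) : Prop :=
  ∀ i j, ∃ k : ℤ,
    ((A : Matrix (Fin d) (Fin d) ℝ)ᵀ * (B : Matrix (Fin d) (Fin d) ℝ)) i j = k

theorem IsIntegralPair.exists_inner_eq {d : ℕ} {A B : GL (Fin d) ℝ} (h : IsIntegralPair A B)
    (m n : Fin d → ℤ) : ∃ k : ℤ, inner ℝ (latticeVec A m) (latticeVec B n) = (k : ℝ) := by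
  choose c hc using h
  refine ⟨∑ i, ∑ j, m i * c i j * n j, ?_⟩
  have e : inner ℝ (latticeVec A m) (latticeVec B n) =
      (fun i => (m i : ℝ)) ⬝ᵥ
        (((A : Matrix (Fin d) (Fin d) ℝ)ᵀ * (B : Matrix (Fin d) (Fin d) ℝ)) *ᵥ
          fun i => (n i : ℝ)) := by
    rw [← Matrix.mulVec_mulVec, Matrix.dotProduct_mulVec, Matrix.vecMul_transpose]
    simp [latticeVec, EuclideanSpace.inner_eq_star_dotProduct, dotProduct_comm]
  rw [e]
  simp only [dotProduct, Matrix.mulVec, hc, Finset.mul_sum]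
  push_cast
  simp only [mul_assoc]

/-- The lattice subgroup `Γ = Aℤᵈ × Bℤᵈ × ℤ` of `ℍᵈ`. -/
def heisLattice {d : ℕ} (A B : GL (Fin d) ℝ) (h : IsIntegralPair A B) : Subgroup (Heis d) where
  carrier := {x | (∃ m : Fin d → ℤ, x.p = latticeVec A m) ∧
    (∃ n : Fin d → ℤ, x.q = latticeVec B n) ∧ ∃ k : ℤ, x.t = k}
  one_mem' := ⟨⟨0, by simp [latticeVec_zero]⟩, ⟨0, by simp [latticeVec_zero]⟩, ⟨0, by simp⟩⟩
  mul_mem' := by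
    rintro x y ⟨⟨m, hm⟩, ⟨n, hn⟩, ⟨k, hk⟩⟩ ⟨⟨m', hm'⟩, ⟨n', hn'⟩, ⟨k', hk'⟩⟩
    obtain ⟨c, hc⟩ := h.exists_inner_eq m n'
    exact ⟨⟨m + m', by simp [latticeVec_add, hm, hm']⟩, ⟨n + n', by simp [latticeVec_add, hn, hn']⟩,
      ⟨k + k' + c, by simp [hk, hk', hm, hn', hc]⟩⟩
  inv_mem' := by
    rintro x ⟨⟨m, hm⟩, ⟨n, hn⟩, ⟨k, hk⟩⟩
    obtain ⟨c, hc⟩ := h.exists_inner_eq m n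
    exact ⟨⟨-m, by simp [latticeVec_neg, hm]⟩, ⟨-n, by simp [latticeVec_neg, hn]⟩,
      ⟨-k + c, by simp [hk, hm, hn, hc]⟩⟩

/-- The subset `Γ₁ = Aℤᵈ × Bℤᵈ`, embedded in `ℍᵈ` as `Aℤᵈ × Bℤᵈ × {0}`. -/
def heisLattice₁ {d : ℕ} (A B : GL (Fin d) ℝ) : Set (Heis d) :=
  {x | ∃ m n : Fin d → ℤ, x = Heis.mk (latticeVec A m) (latticeVec B n) 0}

/-- The closed linear span of the left translates `L_γ ψ`, `γ ∈ Γ`. -/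
def cyclicSpan {d : ℕ} (Γ : Subgroup (Heis d)) (ψ : L2H d) : Submodule ℂ (L2H d) :=
  (Submodule.span ℂ (Set.range fun γ : Γ => leftTranslate (γ : Heis d) ψ)).topologicalClosure

end

noncomputable section

/-! Left translations are isometric and multiplicative, so the family is orthonormal iff `L_γ ψ` is
orthogonal to `ψ` for `γ ≠ 1` in `Γ` and `ψ` has norm one. Every `γ ∈ Γ` is a central element
`(0,0,k)`, `k ∈ ℤ`, times an element of `Γ₁`. Under `Π_l` the centre acts by the scalar `e^{2πilt}`,
so the Fourier transform turns translation by `(0,0,k)` into multiplication by `e^{2πilk}`, and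
`e^{2πi(α+j)k} = e^{2πiαk}` for integers `j`. Plancherel, followed by folding `ℝ` onto `(0,1]`,
therefore identifies the pairing of `L_{(0,0,k)} φ` with `χ` as the Fourier coefficient `∫₀¹
[φ,χ](α) e^{2πiαk} dα` (`integral_bracket_mul_exp`). For `φ = ψ`, `χ = L_{γ₁} ψ`, both sides of the
equivalence prescribe the same coefficients, and these determine an integrable function on `(0,1]`
(`bracket_ae_eq_const_iff`).

Plancherel on `ℍᵈ` is proved from the Euclidean one. For `u ∈ L¹ ∩ L²` the operator `∫ u Π_l` has a
kernel obtained from `u` by a Fourier transform in `(q,t)`; its Hilbert–Schmidt norm is the `L²`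
norm of that kernel (`IsFourierIntegral.hsNormSq_eq`), and the scaling `η = l y` of the kernel
variable produces the weight `|l|ᵈ`. Approximation carries the identity to `L²`
(`exists_isGroupFourier`, `IsGroupFourier.fieldNormSq_eq`), and polarization turns it into one for
inner products (`IsGroupFourier.integral_hsInner`). -/

theorem HilbertBasis.tsum_enorm_inner_sq {ι E : Type*} [NormedAddCommGroup E]
    [InnerProductSpace ℂ E] (b : HilbertBasis ι ℂ E) (x : E) :
    ∑' i, ‖inner ℂ (b i) x‖ₑ ^ 2 = ‖x‖ₑ ^ 2 := by
  have h : HasSum (fun i => ‖inner ℂ (b i) x‖ ^ 2) (‖x‖ ^ 2) := by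
    have h1 := b.hasSum_inner_mul_inner x x
    have h2 := Complex.hasSum_re h1
    have h3 : (inner ℂ x x : ℂ).re = ‖x‖ ^ 2 := by
      rw [inner_self_eq_norm_sq_to_K]; norm_cast
    rw [h3] at h2
    refine h2.congr_fun ?_
    intro i
    rw [← inner_conj_symm x (b i), ← Complex.normSq_eq_conj_mul_self, Complex.ofReal_re,
      Complex.normSq_eq_norm_sq]
  have e : ∀ y : ℂ, ‖y‖ₑ ^ 2 = ENNReal.ofReal (‖y‖ ^ 2) := fun y => by
    rw [← ofReal_norm, ENNReal.ofReal_pow (norm_nonneg _)]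
  simp_rw [e]
  rw [← ENNReal.ofReal_tsum_of_nonneg (fun i => by positivity) h.summable, h.tsum_eq,
    ENNReal.ofReal_pow (norm_nonneg _), ofReal_norm]

/-! ### Hilbert–Schmidt norms with values in `[0, ∞]` -/

section HilbertSchmidt

variable {E : Type*} [NormedAddCommGroup E] [InnerProductSpace ℂ E] [CompleteSpace E]

/-- Parseval makes both sides the double sum of squared moduli of matrix entries, summed in either
order. -/
theorem hsNormSq_adjoint (T : E →L[ℂ] E) :
    hsNormSq (ContinuousLinearMap.adjoint T) = hsNormSq T := by
  unfold hsNormSq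
  calc ∑' i, ‖ContinuousLinearMap.adjoint T (onb E i)‖ₑ ^ 2
      = ∑' i, ∑' j, ‖inner ℂ (onb E j) (ContinuousLinearMap.adjoint T (onb E i))‖ₑ ^ 2 := by
        simp_rw [(onb E).tsum_enorm_inner_sq]
    _ = ∑' j, ∑' i, ‖inner ℂ (onb E i) (T (onb E j))‖ₑ ^ 2 := by
        rw [ENNReal.tsum_comm]
        refine tsum_congr fun j => tsum_congr fun i => ?_
        rw [ContinuousLinearMap.adjoint_inner_right, ← inner_conj_symm, RCLike.enorm_conj]
    _ = _ := by simp_rw [(onb E).tsum_enorm_inner_sq]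

/-- The coefficients of `T x` are `⟨T† eᵢ, x⟩`; Cauchy–Schwarz bounds each one, and passing to the
adjoint does not change the Hilbert–Schmidt norm. -/
theorem enorm_apply_sq_le_hsNormSq (T : E →L[ℂ] E) (x : E) :
    ‖T x‖ₑ ^ 2 ≤ hsNormSq T * ‖x‖ₑ ^ 2 := by
  rw [← hsNormSq_adjoint, hsNormSq, ← ENNReal.tsum_mul_right, ← (onb E).tsum_enorm_inner_sq]
  refine ENNReal.tsum_le_tsum fun i => ?_
  rw [← ContinuousLinearMap.adjoint_inner_left, ← mul_pow]
  gcongr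
  simpa only [enorm_eq_nnnorm, ← ENNReal.coe_mul, ENNReal.coe_le_coe] using
    nnnorm_inner_le_nnnorm (𝕜 := ℂ) (ContinuousLinearMap.adjoint T (onb E i)) x

theorem norm_le_sqrt_hsNormSq (T : E →L[ℂ] E) (h : hsNormSq T ≠ ∞) :
    ‖T‖ ≤ √(hsNormSq T).toReal := by
  refine T.opNorm_le_bound (Real.sqrt_nonneg _) fun x => ?_
  have h1 := enorm_apply_sq_le_hsNormSq T x
  have h2 := ENNReal.toReal_mono (ENNReal.mul_ne_top h (by simp)) h1
  simp only [ENNReal.toReal_pow, toReal_enorm, ENNReal.toReal_mul] at h2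
  rw [← Real.sqrt_sq (norm_nonneg x), ← Real.sqrt_mul ENNReal.toReal_nonneg]
  exact Real.le_sqrt_of_sq_le h2

theorem hsNormSq_smul (c : ℂ) (T : E →L[ℂ] E) : hsNormSq (c • T) = ‖c‖ₑ ^ 2 * hsNormSq T := by
  simp [hsNormSq, enorm_smul, mul_pow, ENNReal.tsum_mul_left]

theorem hsNormSq_neg (T : E →L[ℂ] E) : hsNormSq (-T) = hsNormSq T := by
  simp [hsNormSq]

/-- The Hilbert–Schmidt norm is subadditive. -/
theorem sqrt_hsNormSq_add_le (S T : E →L[ℂ] E) :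
    hsNormSq (S + T) ^ (1 / 2 : ℝ) ≤ hsNormSq S ^ (1 / 2 : ℝ) + hsNormSq T ^ (1 / 2 : ℝ) := by
  let _ : MeasurableSpace (onbSet E) := ⊤
  have h := ENNReal.lintegral_Lp_add_le (μ := (Measure.count : Measure (onbSet E))) (p := 2)
    (f := fun i => ‖S (onb E i)‖ₑ) (g := fun i => ‖T (onb E i)‖ₑ)
    measurable_from_top.aemeasurable measurable_from_top.aemeasurable (by norm_num)
  simp only [lintegral_count, Pi.add_apply, ENNReal.rpow_two] at h
  refine le_trans ?_ h
  refine ENNReal.rpow_le_rpow (ENNReal.tsum_le_tsum fun i => ?_) (by norm_num)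
  gcongr
  simpa using enorm_add_le _ _

theorem hsNormSq_add_ne_top {S T : E →L[ℂ] E} (hS : hsNormSq S ≠ ∞) (hT : hsNormSq T ≠ ∞) :
    hsNormSq (S + T) ≠ ∞ := by
  intro h
  have := sqrt_hsNormSq_add_le S T
  rw [h, ENNReal.top_rpow_of_pos (by norm_num), top_le_iff, ENNReal.add_eq_top] at this
  rcases this with h | h
  · exact ENNReal.rpow_ne_top_of_nonneg (by norm_num) hS h
  · exact ENNReal.rpow_ne_top_of_nonneg (by norm_num) hT h

/-- Lower semicontinuity of the Hilbert–Schmidt norm under strong convergence. -/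
theorem hsNormSq_le_liminf {T : ℕ → E →L[ℂ] E} {S : E →L[ℂ] E}
    (h : ∀ x, Tendsto (fun n => T n x) atTop (𝓝 (S x))) :
    hsNormSq S ≤ liminf (fun n => hsNormSq (T n)) atTop := by
  let _ : MeasurableSpace (onbSet E) := ⊤
  have h1 := lintegral_liminf_le (μ := (Measure.count : Measure (onbSet E)))
    (u := atTop) (f := fun (n : ℕ) i => ‖T n (onb E i)‖ₑ ^ 2) (fun n => measurable_from_top)
  simp only [lintegral_count] at h1
  refine le_trans (le_of_eq ?_) h1
  refine tsum_congr fun i => ?_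
  exact ((ENNReal.continuous_pow 2).tendsto _ |>.comp
    ((continuous_enorm.tendsto _).comp (h (onb E i)))).liminf_eq.symm

/-- The trace is `∑ ⟨S† eᵢ, T† eᵢ⟩`, and the scalar polarization identity applies termwise;
finiteness of the norms makes the four series converge separately. This reduces all later statements
about `hsInner` to statements about `hsNormSq`. -/
theorem hsInner_eq_polarization {S T : E →L[ℂ] E} (hS : hsNormSq S ≠ ∞) (hT : hsNormSq T ≠ ∞) :
    hsInner S T = (((hsNormSq (S + T)).toReal : ℂ) - ((hsNormSq (S - T)).toReal : ℂ) +
      (((hsNormSq (S + Complex.I • T)).toReal : ℂ) - ((hsNormSq (S - Complex.I • T)).toReal : ℂ)) *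
        Complex.I) / 4 := by
  have key : ∀ R : E →L[ℂ] E, hsNormSq R ≠ ∞ →
      HasSum (fun i => ((‖ContinuousLinearMap.adjoint R (onb E i)‖ : ℂ) ^ 2))
        ((hsNormSq R).toReal : ℂ) := by
    intro R hR
    rw [← hsNormSq_adjoint] at hR ⊢
    have h1 : ∀ i, ‖ContinuousLinearMap.adjoint R (onb E i)‖ₑ ^ 2 ≠ ∞ := fun i => by simp
    have h2 := ENNReal.hasSum_toReal (f := fun i => ‖ContinuousLinearMap.adjoint R (onb E i)‖ₑ ^ 2) hR
    rw [← ENNReal.tsum_toReal_eq h1] at h2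
    have h3 := Complex.hasSum_ofReal.mpr h2
    simpa [hsNormSq] using h3
  have hIT : hsNormSq (Complex.I • T) ≠ ∞ := by
    rw [hsNormSq_smul]; exact ENNReal.mul_ne_top (by simp) hT
  have sub : ∀ {R : E →L[ℂ] E}, hsNormSq R ≠ ∞ → hsNormSq (S - R) ≠ ∞ := fun {R} hR => by
    rw [sub_eq_add_neg]; exact hsNormSq_add_ne_top hS (by rwa [hsNormSq_neg])
  have h := (((key _ (hsNormSq_add_ne_top hS hT)).sub (key _ (sub hT))).add
    (((key _ (hsNormSq_add_ne_top hS hIT)).sub (key _ (sub hIT))).mul_right Complex.I)).div_const 4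
  rw [← h.tsum_eq, hsInner, opTrace]
  refine tsum_congr fun i => ?_
  -- The adjoint is conjugate linear, so `S ± iT` becomes `S† ∓ iT†`, which matches the signs of the
  -- scalar identity.
  rw [ContinuousLinearMap.comp_apply, ← ContinuousLinearMap.adjoint_inner_left,
    inner_eq_sum_norm_sq_div_four]
  simp [map_add, sub_eq_add_neg, LinearIsometryEquiv.map_smulₛₗ]

end HilbertSchmidt

theorem MeasureTheory.Lp.lintegral_enorm_sq {α : Type*} [MeasurableSpace α] {μ : Measure α}
    (g : Lp ℂ 2 μ) : ∫⁻ x, ‖g x‖ₑ ^ 2 ∂μ = ‖g‖ₑ ^ 2 := by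
  rw [Lp.enorm_def, eLpNorm_eq_lintegral_rpow_enorm_toReal (by norm_num) (by norm_num)]
  rw [← ENNReal.rpow_natCast, ← ENNReal.rpow_mul]
  simp

/-! ### Euclidean Plancherel on `L¹ ∩ L²` -/

section Plancherel
open FourierTransform SchwartzMap

variable {V : Type*} [NormedAddCommGroup V] [InnerProductSpace ℝ V] [FiniteDimensional ℝ V]
  [MeasurableSpace V] [BorelSpace V]

/-- On `L¹ ∩ L²` the Fourier integral represents the `L²` Fourier transform. -/
theorem MeasureTheory.MemLp.fourier_toLp_ae_eq {f : V → ℂ} (h1 : Integrable f) (h2 : MemLp f 2) :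
    (𝓕 h2.toLp : Lp ℂ 2 (volume : Measure V)) =ᵐ[volume] 𝓕 f := by
  refine ae_eq_of_integral_contDiff_smul_eq
    ((Lp.memLp _).locallyIntegrable (by norm_num))
    ((VectorFourier.fourierIntegral_continuous Real.continuous_fourierChar
      (by exact continuous_inner) h1).locallyIntegrable) fun g hg hgs => ?_
  have hgs' : HasCompactSupport (fun x => (g x : ℂ)) := hgs.comp_left Complex.ofReal_zero
  have hg' : ContDiff ℝ ((⊤ : ℕ∞) : WithTop ℕ∞) (fun x => (g x : ℂ)) := 
    Complex.ofRealCLM.contDiff.comp hg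
  set G : 𝓢(V, ℂ) := hgs'.toSchwartzMap hg' with hG
  have hGx : ∀ x, G x = (g x : ℂ) := fun x => rfl
  -- Against a test function `G`, both transforms give `∫ 𝓕G · f`: the `L²` one because it agrees
  -- with the distributional transform, the integral one (`e3`) by Fubini.
  have e := congrArg (fun D => D G) (Lp.fourier_toTemperedDistribution_eq h2.toLp)
  simp only [TemperedDistribution.fourier_apply, Lp.toTemperedDistribution_apply] at e
  have e3 := VectorFourier.integral_fourierIntegral_smul_eq_flip (μ := (volume : Measure V))
    (ν := (volume : Measure V)) (L := innerₗ V) (f := (G : V → ℂ)) (g := f)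
    Real.continuous_fourierChar (by exact continuous_inner) G.integrable h1
  simp only [flip_innerₗ] at e3
  calc ∫ x, g x • (𝓕 h2.toLp : Lp ℂ 2 (volume : Measure V)) x
      = ∫ x, G x • (𝓕 h2.toLp : Lp ℂ 2 (volume : Measure V)) x := by
        simp [hGx]
    _ = ∫ x, (𝓕 G) x • (h2.toLp f) x := e.symm
    _ = ∫ x, (𝓕 G) x • f x := by
        refine integral_congr_ae ?_
        filter_upwards [h2.coeFn_toLp] with x hx
        rw [hx]
    _ = ∫ x, G x • 𝓕 f x := e3
    _ = _ := by simp [hGx]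

/-- Plancherel's identity for the Fourier integral on `L¹ ∩ L²`. -/
theorem lintegral_enorm_fourier_sq {f : V → ℂ} (h1 : Integrable f) (h2 : MemLp f 2) :
    ∫⁻ x, ‖𝓕 f x‖ₑ ^ 2 = ∫⁻ x, ‖f x‖ₑ ^ 2 := by
  have a := Lp.lintegral_enorm_sq (𝓕 h2.toLp)
  have b := Lp.lintegral_enorm_sq h2.toLp
  have c : ‖(𝓕 h2.toLp : Lp ℂ 2 (volume : Measure V))‖ₑ = ‖h2.toLp‖ₑ := by
    rw [← ofReal_norm, Lp.norm_fourier_eq, ofReal_norm]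
  rw [c, ← b] at a
  have a1 : ∫⁻ x, ‖𝓕 f x‖ₑ ^ 2 = _ := lintegral_congr_ae (by
    filter_upwards [h2.fourier_toLp_ae_eq h1] with x hx
    rw [← hx])
  rw [a1, a]
  refine lintegral_congr_ae ?_
  filter_upwards [h2.coeFn_toLp] with x hx
  rw [hx]

/-- The Fourier integral in the variables `(q, t)`, at the frequency `(η, -l)`. -/
def centralFourier {d : ℕ} (v : EuclideanSpace ℝ (Fin d) × ℝ → ℂ) (η : EuclideanSpace ℝ (Fin d))
    (l : ℝ) : ℂ :=
  ∫ w, v w * (Complex.exp (2 * Real.pi * Complex.I * l * w.2) *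
    Complex.exp (-(2 * Real.pi * Complex.I * (inner ℝ w.1 η : ℝ))))

/-- This is Plancherel on `ℝᵈ × ℝ`. The plain product carries the sup norm, so the integrals are
moved to the Euclidean product `WithLp 2`; the reflection `l ↦ -l` accounts for the sign of the
`t`-phase. -/
theorem lintegral_enorm_centralFourier_sq {d : ℕ} {v : EuclideanSpace ℝ (Fin d) × ℝ → ℂ}
    (h1 : Integrable v) (h2 : MemLp v 2) :
    ∫⁻ ξ : EuclideanSpace ℝ (Fin d) × ℝ, ‖centralFourier v ξ.1 ξ.2‖ₑ ^ 2 =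
      ∫⁻ w, ‖v w‖ₑ ^ 2 := by
  have hP := WithLp.volume_preserving_ofLp (EuclideanSpace ℝ (Fin d)) ℝ
  have hQ := WithLp.volume_preserving_toLp (EuclideanSpace ℝ (Fin d)) ℝ
  have hemb : MeasurableEmbedding (@WithLp.ofLp 2 (EuclideanSpace ℝ (Fin d) × ℝ)) :=
    (MeasurableEquiv.toLp 2 (EuclideanSpace ℝ (Fin d) × ℝ)).symm.measurableEmbedding
  have hembQ : MeasurableEmbedding (@WithLp.toLp 2 (EuclideanSpace ℝ (Fin d) × ℝ)) :=
    (MeasurableEquiv.toLp 2 (EuclideanSpace ℝ (Fin d) × ℝ)).measurableEmbedding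
  have hn : MeasurePreserving (fun ξ : EuclideanSpace ℝ (Fin d) × ℝ => (ξ.1, -ξ.2)) volume volume :=
    (MeasurePreserving.id _).prod (Measure.measurePreserving_neg (volume : Measure ℝ))
  have hp := lintegral_enorm_fourier_sq (f := v ∘ @WithLp.ofLp 2 (EuclideanSpace ℝ (Fin d) × ℝ))
    ((hP.integrable_comp_emb hemb).2 h1) (h2.comp_measurePreserving hP)
  have e1 := hP.lintegral_comp_emb hemb (fun w => ‖v w‖ₑ ^ 2)
  rw [← e1]
  refine Eq.trans ?_ hp
  rw [← hQ.lintegral_comp_emb hembQ, ← hn.lintegral_comp_emb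
    ((MeasurableEquiv.refl _).prodCongr (MeasurableEquiv.neg ℝ)).measurableEmbedding]
  refine lintegral_congr fun ξ => ?_
  congr 2
  rw [Real.fourier_eq', centralFourier, ← hP.integral_comp hemb]
  refine integral_congr_ae (Eventually.of_forall fun w => ?_)
  simp only [Function.comp_apply, WithLp.prod_inner_apply, smul_eq_mul, ← Complex.exp_add]
  rw [mul_comm]
  congr 2
  simp
  ring

end Plancherel

/-! ### Separability and measurability of Hilbert–Schmidt norms -/

section Countable

/-- Basis vectors are at distance `√2 > 1`, so the balls of radius `1/2` around them are disjoint
open sets in a separable space. -/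
theorem HilbertBasis.countable_index {ι E : Type*} [NormedAddCommGroup E] [InnerProductSpace ℂ E]
    [TopologicalSpace.SeparableSpace E] (b : HilbertBasis ι ℂ E) : Countable ι := by
  have hd : Pairwise (Function.onFun Disjoint fun i => Metric.ball (b i) (1 / 2)) := by
    intro i j hij
    refine Metric.ball_disjoint_ball ?_
    have h0 : inner ℂ (b i) (b j) = (0 : ℂ) := b.orthonormal.2 hij
    have h1 : ‖b i - b j‖ ^ 2 = 2 := by
      rw [@norm_sub_sq ℂ, h0, b.orthonormal.1, b.orthonormal.1]; norm_num
    rw [dist_eq_norm]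
    nlinarith [norm_nonneg (b i - b j)]
  have := hd.countable_of_isOpen_disjoint (fun i => Metric.isOpen_ball)
    (fun i => ⟨b i, Metric.mem_ball_self (by norm_num)⟩)
  exact this

instance (d : ℕ) : TopologicalSpace.SeparableSpace (L2R d) := by
  have : Fact ((2 : ℝ≥0∞) ≠ ∞) := ⟨by norm_num⟩
  infer_instance

instance (d : ℕ) : Countable (onbSet (L2R d)) := (onb (L2R d)).countable_index

/-- A weakly measurable field of operators has a measurable Hilbert–Schmidt norm. -/
theorem aemeasurable_hsNormSq {d : ℕ} {α : Type*} [MeasurableSpace α] {μ : Measure α}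
    {F : α → L2R d →L[ℂ] L2R d}
    (hF : ∀ f g : L2R d, AEMeasurable (fun l => inner ℂ g (F l f)) μ) :
    AEMeasurable (fun l => hsNormSq (F l)) μ := by
  have : ∀ l, hsNormSq (F l) =
      ∑' i, ∑' j, ‖inner ℂ (onb (L2R d) j) (F l (onb (L2R d) i))‖ₑ ^ 2 := fun l => by
    simp_rw [HilbertBasis.tsum_enorm_inner_sq]; rfl
  simp_rw [this]
  exact AEMeasurable.tsum fun i => AEMeasurable.tsum fun j =>
    ((hF _ _).enorm).pow_const 2

end Countable

namespace Heis

variable {d : ℕ}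

instance : SigmaFinite (volume : Measure (Heis d)) :=
  inferInstanceAs (SigmaFinite
    (volume : Measure (EuclideanSpace ℝ (Fin d) × EuclideanSpace ℝ (Fin d) × ℝ)))

theorem measurable_p : Measurable (p : Heis d → _) :=
  measurable_fst (α := EuclideanSpace ℝ (Fin d)) (β := EuclideanSpace ℝ (Fin d) × ℝ)

theorem measurable_q : Measurable (q : Heis d → _) :=
  (measurable_fst (α := EuclideanSpace ℝ (Fin d)) (β := ℝ)).comp
    (measurable_snd (α := EuclideanSpace ℝ (Fin d)) (β := EuclideanSpace ℝ (Fin d) × ℝ))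

theorem measurable_t : Measurable (t : Heis d → _) :=
  (measurable_snd (α := EuclideanSpace ℝ (Fin d)) (β := ℝ)).comp
    (measurable_snd (α := EuclideanSpace ℝ (Fin d)) (β := EuclideanSpace ℝ (Fin d) × ℝ))

end Heis

/-! ### The Schrödinger representation and its weak integrals -/

section Schrodinger

variable {d : ℕ}

theorem measurable_schrodingerPhase :
    Measurable fun z : ℝ × Heis d × EuclideanSpace ℝ (Fin d) =>
      schrodingerPhase z.1 z.2.1 z.2.2 := by
  have h1 : Measurable fun z : ℝ × Heis d × EuclideanSpace ℝ (Fin d) => z.2.1.q :=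
    Heis.measurable_q.comp (by fun_prop)
  have h2 : Measurable fun z : ℝ × Heis d × EuclideanSpace ℝ (Fin d) => z.2.1.t :=
    Heis.measurable_t.comp (by fun_prop)
  unfold schrodingerPhase
  fun_prop

theorem coeFn_schrodinger (l : ℝ) (x : Heis d) (f : L2R d) :
    schrodinger l x f =ᵐ[volume] fun y => schrodingerPhase l x y * f (y - x.p) :=
  MemLp.coeFn_toLp _

theorem ae_comp_sub_right {P : EuclideanSpace ℝ (Fin d) → Prop} (h : ∀ᵐ y, P y)
    (p : EuclideanSpace ℝ (Fin d)) : ∀ᵐ y, P (y - p) :=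
  (measurePreserving_sub_right volume p).quasiMeasurePreserving.ae h

theorem schrodinger_add (l : ℝ) (x : Heis d) (f g : L2R d) :
    schrodinger l x (f + g) = schrodinger l x f + schrodinger l x g := by
  refine Lp.ext ?_
  filter_upwards [coeFn_schrodinger l x (f + g), coeFn_schrodinger l x f,
    coeFn_schrodinger l x g, Lp.coeFn_add (schrodinger l x f) (schrodinger l x g),
    ae_comp_sub_right (Lp.coeFn_add f g) x.p] with y h1 h2 h3 h4 h5
  rw [h1, h4, Pi.add_apply, h2, h3, h5, Pi.add_apply, mul_add]

theorem schrodinger_smul (l : ℝ) (x : Heis d) (c : ℂ) (f : L2R d) :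
    schrodinger l x (c • f) = c • schrodinger l x f := by
  refine Lp.ext ?_
  filter_upwards [coeFn_schrodinger l x (c • f), coeFn_schrodinger l x f,
    Lp.coeFn_smul c (schrodinger l x f),
    ae_comp_sub_right (Lp.coeFn_smul c f) x.p] with y h1 h2 h4 h5
  rw [h1, h4, Pi.smul_apply, h2, h5, Pi.smul_apply, smul_eq_mul, smul_eq_mul, mul_left_comm]

theorem norm_schrodinger (l : ℝ) (x : Heis d) (f : L2R d) : ‖schrodinger l x f‖ = ‖f‖ := by
  rw [schrodinger, Lp.norm_toLp, Lp.norm_def]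
  congr 1
  rw [← eLpNorm_comp_measurePreserving (Lp.aestronglyMeasurable f)
    (measurePreserving_sub_right volume x.p)]
  refine eLpNorm_congr_norm_ae (Eventually.of_forall fun y => ?_)
  simp [norm_schrodingerPhase]

theorem inner_schrodinger (l : ℝ) (x : Heis d) (f g : L2R d) :
    inner ℂ g (schrodinger l x f) =
      ∫ y, schrodingerPhase l x y * f (y - x.p) * (starRingEnd ℂ) (g y) := by
  rw [L2.inner_def]
  refine integral_congr_ae ?_
  filter_upwards [coeFn_schrodinger l x f] with y h
  rw [h, RCLike.inner_apply]

theorem stronglyMeasurable_schrodinger_integrand (f g : L2R d) :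
    StronglyMeasurable fun z : ℝ × Heis d × EuclideanSpace ℝ (Fin d) =>
      schrodingerPhase z.1 z.2.1 z.2.2 * f (z.2.2 - z.2.1.p) * (starRingEnd ℂ) (g z.2.2) := by
  have h1 : Measurable fun z : ℝ × Heis d × EuclideanSpace ℝ (Fin d) => z.2.2 - z.2.1.p :=
    Measurable.sub (by fun_prop) (Heis.measurable_p.comp (by fun_prop))
  have h2 : Measurable fun z : ℝ × Heis d × EuclideanSpace ℝ (Fin d) => z.2.2 := by fun_prop
  refine ((measurable_schrodingerPhase.stronglyMeasurable).mul
    ((Lp.stronglyMeasurable f).comp_measurable h1)).mul ?_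
  exact RCLike.continuous_conj.comp_stronglyMeasurable
    ((Lp.stronglyMeasurable g).comp_measurable h2)

theorem stronglyMeasurable_inner_schrodinger (f g : L2R d) :
    StronglyMeasurable fun z : ℝ × Heis d => inner ℂ g (schrodinger z.1 z.2 f) := by
  simp_rw [inner_schrodinger]
  refine StronglyMeasurable.integral_prod_right (f := fun (z : ℝ × Heis d) y =>
    schrodingerPhase z.1 z.2 y * f (y - z.2.p) * (starRingEnd ℂ) (g y)) ?_
  exact (stronglyMeasurable_schrodinger_integrand f g).comp_measurable
    (g := fun z : (ℝ × Heis d) × EuclideanSpace ℝ (Fin d) => (z.1.1, z.1.2, z.2)) (by fun_prop)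

theorem norm_inner_schrodinger_le (l : ℝ) (x : Heis d) (f g : L2R d) :
    ‖inner ℂ g (schrodinger l x f)‖ ≤ ‖g‖ * ‖f‖ := by
  simpa [norm_schrodinger] using norm_inner_le_norm (𝕜 := ℂ) g (schrodinger l x f)

theorem integrable_mul_inner_schrodinger {u : L2H d} (hu : Integrable u) (l : ℝ) (f g : L2R d) :
    Integrable fun x => u x * inner ℂ g (schrodinger l x f) := by
  refine hu.mul_bdd (c := ‖g‖ * ‖f‖) ?_ (Eventually.of_forall fun x =>
    norm_inner_schrodinger_le l x f g)
  exact ((stronglyMeasurable_inner_schrodinger f g).comp_measurable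
    (g := fun x : Heis d => (l, x)) (by fun_prop)).aestronglyMeasurable

/-- The operator `∫ u(x) Π_l(x) dx` exists for integrable `u`. -/
theorem exists_isFourierIntegral {u : L2H d} (hu : Integrable u) (l : ℝ) :
    ∃ T, IsFourierIntegral u l T := by
  -- The weak integral is a sesquilinear form in `(g, f)` bounded by `‖u‖₁ ‖g‖ ‖f‖`; the Riesz
  -- representation yields the operator, with an adjoint to put `f` in the right slot.
  let B₀ : L2R d →ₗ⋆[ℂ] L2R d →ₗ[ℂ] ℂ := LinearMap.mk₂'ₛₗ (starRingEnd ℂ) (RingHom.id ℂ)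
    (fun g f => ∫ x : Heis d, u x * inner ℂ g (schrodinger l x f))
    (fun g g' f => by
      simp only [inner_add_left, mul_add]
      exact integral_add (integrable_mul_inner_schrodinger hu l f g)
        (integrable_mul_inner_schrodinger hu l f g'))
    (fun c g f => by
      simp only [inner_smul_left, smul_eq_mul, ← integral_const_mul]
      congr 1; ext x; ring)
    (fun g f f' => by
      simp only [schrodinger_add, inner_add_right, mul_add]
      exact integral_add (integrable_mul_inner_schrodinger hu l f g)
        (integrable_mul_inner_schrodinger hu l f' g))
    (fun c g f => by
      simp only [schrodinger_smul, inner_smul_right, smul_eq_mul, ← integral_const_mul,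
        RingHom.id_apply]
      congr 1; ext x; ring)
  let B := B₀.mkContinuous₂ (∫ x, ‖u x‖) (fun g f => by
    change ‖∫ x : Heis d, u x * inner ℂ g (schrodinger l x f)‖ ≤ _
    rw [mul_assoc, ← integral_mul_const]
    refine norm_integral_le_of_norm_le (hu.norm.mul_const _) (Eventually.of_forall fun x => ?_)
    rw [norm_mul]
    gcongr
    exact norm_inner_schrodinger_le l x f g)
  refine ⟨ContinuousLinearMap.adjoint (InnerProductSpace.continuousLinearMapOfBilin B),
    fun f g => ?_⟩
  rw [ContinuousLinearMap.adjoint_inner_right,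
    InnerProductSpace.continuousLinearMapOfBilin_apply]
  rfl

theorem IsFourierIntegral.add {u v : L2H d} (hu : Integrable u) (hv : Integrable v) {l : ℝ}
    {S T : L2R d →L[ℂ] L2R d} (hS : IsFourierIntegral u l S) (hT : IsFourierIntegral v l T) :
    IsFourierIntegral (u + v) l (S + T) := by
  intro f g
  rw [add_apply, inner_add_right, hS, hT, ← integral_add
    (integrable_mul_inner_schrodinger hu l f g) (integrable_mul_inner_schrodinger hv l f g)]
  refine integral_congr_ae ?_
  filter_upwards [Lp.coeFn_add u v] with x hx
  rw [hx, Pi.add_apply, add_mul]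

theorem IsFourierIntegral.smul {u : L2H d} (c : ℂ) {l : ℝ}
    {T : L2R d →L[ℂ] L2R d} (hT : IsFourierIntegral u l T) :
    IsFourierIntegral (c • u) l (c • T) := by
  intro f g
  rw [smul_apply, inner_smul_right, hT, ← integral_const_mul]
  refine integral_congr_ae ?_
  filter_upwards [Lp.coeFn_smul c u] with x hx
  rw [hx, Pi.smul_apply, smul_eq_mul, mul_assoc]

theorem IsFourierIntegral.aemeasurable {u : L2H d}
    {T : ℝ → L2R d →L[ℂ] L2R d} (hT : ∀ l, IsFourierIntegral u l (T l)) (f g : L2R d) :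
    AEMeasurable (fun l => inner ℂ g (T l f)) volume := by
  simp_rw [fun l => hT l f g]
  refine (StronglyMeasurable.integral_prod_right (f := fun (l : ℝ) (x : Heis d) =>
    u x * inner ℂ g (schrodinger l x f)) ?_).measurable.aemeasurable
  exact ((Lp.stronglyMeasurable u).comp_measurable measurable_snd).mul
    (stronglyMeasurable_inner_schrodinger f g)

/-- Supplies Fubini's hypothesis. The inequality `2ab ≤ a² + b²` and translation invariance bound
the `y`-integral by `|u(x)| (‖f‖² + ‖g‖²)`, uniformly in the translation `p`. -/
theorem integrable_schrodinger_integrand {u : L2H d} (hu : Integrable u) (l : ℝ) (f g : L2R d) :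
    Integrable (fun z : Heis d × EuclideanSpace ℝ (Fin d) =>
      u z.1 * (schrodingerPhase l z.1 z.2 * f (z.2 - z.1.p) * (starRingEnd ℂ) (g z.2)))
      (volume.prod volume) := by
  have hm : StronglyMeasurable (fun z : Heis d × EuclideanSpace ℝ (Fin d) =>
      u z.1 * (schrodingerPhase l z.1 z.2 * f (z.2 - z.1.p) * (starRingEnd ℂ) (g z.2))) :=
    ((Lp.stronglyMeasurable u).comp_measurable measurable_fst).mul
      ((stronglyMeasurable_schrodinger_integrand f g).comp_measurable
        (g := fun z : Heis d × EuclideanSpace ℝ (Fin d) => (l, z.1, z.2)) (by fun_prop))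
  have hf : ∀ p, MemLp (fun y => f (y - p)) 2 volume := fun p =>
    (Lp.memLp f).comp_measurePreserving (measurePreserving_sub_right volume p)
  have hfg : ∀ p, Integrable (fun y => f (y - p) * (starRingEnd ℂ) (g y)) := fun p =>
    (hf p).integrable_mul (Lp.memLp g).star
  have hn : ∀ x y, ‖u x * (schrodingerPhase l x y * f (y - x.p) * (starRingEnd ℂ) (g y))‖ =
      ‖u x‖ * ‖f (y - x.p) * (starRingEnd ℂ) (g y)‖ := fun x y => by
    simp [norm_schrodingerPhase]
  rw [integrable_prod_iff hm.aestronglyMeasurable]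
  refine ⟨Eventually.of_forall fun x => ?_, ?_⟩
  · refine ((hfg x.p).norm.const_mul ‖u x‖).mono'
      (hm.comp_measurable (g := fun y : EuclideanSpace ℝ (Fin d) => (x, y))
        (by fun_prop)).aestronglyMeasurable (Eventually.of_forall fun y => (hn x y).le)
  · refine (hu.norm.mul_const ((∫ y, ‖f y‖ ^ 2) + ∫ y, ‖g y‖ ^ 2)).mono' hm.norm.aestronglyMeasurable.integral_prod_right'
      (Eventually.of_forall fun x => ?_)
    rw [Real.norm_of_nonneg (integral_nonneg fun y => norm_nonneg _)]
    simp_rw [hn, integral_const_mul]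
    gcongr
    have hf2 : ∀ p, Integrable (fun y => ‖f (y - p)‖ ^ 2) := fun p =>
      (hf p).integrable_norm_pow two_ne_zero
    have hg2 : Integrable (fun y => ‖g y‖ ^ 2) := (Lp.memLp g).integrable_norm_pow two_ne_zero
    rw [← integral_sub_right_eq_self (fun y => ‖f y‖ ^ 2) x.p, ← integral_add (hf2 _) hg2]
    refine integral_mono (hfg x.p).norm ((hf2 _).add hg2) fun y => ?_
    simp only [norm_mul, RCLike.norm_conj]
    nlinarith [sq_nonneg (‖f (y - x.p)‖ - ‖g y‖), sq_nonneg (‖f (y - x.p)‖), sq_nonneg ‖g y‖]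

end Schrodinger

/-! ### Integral kernel and Hilbert–Schmidt norm of `∫ u(x) Π_l(x) dx` -/

section Kernel

variable {d : ℕ}

/-- The kernel `(y, p) ↦ k(y, p)` for which `∫ u(x) Π_l(x) dx` is the operator
`f ↦ ∫ f(· - p) k(·, p) dp`; here the first variable is scaled to `η = l y`. -/
def schrodingerKernel (u : L2H d) (l : ℝ) (η p : EuclideanSpace ℝ (Fin d)) : ℂ :=
  centralFourier (fun w => u (Heis.mk p w.1 w.2)) η l

theorem stronglyMeasurable_schrodingerKernel (u : L2H d) :
    StronglyMeasurable fun z : ℝ × EuclideanSpace ℝ (Fin d) × EuclideanSpace ℝ (Fin d) =>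
      schrodingerKernel u z.1 z.2.1 z.2.2 := by
  refine StronglyMeasurable.integral_prod_right
    (f := fun (z : ℝ × EuclideanSpace ℝ (Fin d) × EuclideanSpace ℝ (Fin d))
      (w : EuclideanSpace ℝ (Fin d) × ℝ) => u (Heis.mk z.2.2 w.1 w.2) *
        (Complex.exp (2 * Real.pi * Complex.I * z.1 * w.2) *
          Complex.exp (-(2 * Real.pi * Complex.I * (inner ℝ w.1 z.2.1 : ℝ))))) ?_
  have hu : StronglyMeasurable
      (fun z : EuclideanSpace ℝ (Fin d) × EuclideanSpace ℝ (Fin d) × ℝ => u z) :=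
    Lp.stronglyMeasurable u
  refine StronglyMeasurable.mul ?_ (Measurable.stronglyMeasurable ?_)
  · exact hu.comp_measurable
      (g := fun z : (ℝ × EuclideanSpace ℝ (Fin d) × EuclideanSpace ℝ (Fin d)) ×
        (EuclideanSpace ℝ (Fin d) × ℝ) => (z.1.2.2, z.2.1, z.2.2)) (by fun_prop)
  · fun_prop

/-- Fubini for the weak integral defining `∫ u(x) Π_l(x) dx`. -/
theorem IsFourierIntegral.inner_eq {u : L2H d} (hu : Integrable u) {l : ℝ}
    {T : L2R d →L[ℂ] L2R d} (hT : IsFourierIntegral u l T) (f g : L2R d) :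
    Integrable (fun y => (starRingEnd ℂ) (g y) *
        ∫ p, f (y - p) * schrodingerKernel u l (l • y) p) ∧
      inner ℂ g (T f) = ∫ y, (starRingEnd ℂ) (g y) *
        ∫ p, f (y - p) * schrodingerKernel u l (l • y) p := by
  have hH := integrable_schrodinger_integrand hu l f g
  have e : (fun y => ∫ x : Heis d,
      u x * (schrodingerPhase l x y * f (y - x.p) * (starRingEnd ℂ) (g y))) =ᵐ[volume]
      fun y => (starRingEnd ℂ) (g y) * ∫ p, f (y - p) * schrodingerKernel u l (l • y) p := by
    -- For fixed `y`, the integral over `(q, t)` is the kernel at `η = l y`, because `l (q · y) = q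
    -- · (l y)`.
    filter_upwards [hH.prod_left_ae] with y hy
    refine (integral_prod (μ := (volume : Measure (EuclideanSpace ℝ (Fin d))))
      (ν := (volume : Measure (EuclideanSpace ℝ (Fin d) × ℝ))) _ hy).trans ?_
    rw [← integral_const_mul]
    congr 1
    ext p
    rw [schrodingerKernel, centralFourier, ← integral_const_mul, ← integral_const_mul]
    congr 1
    ext w
    change u (Heis.mk p w.1 w.2) * (Complex.exp (2 * Real.pi * Complex.I * l * w.2) *
      Complex.exp (-(2 * Real.pi * Complex.I * l * (inner ℝ w.1 y : ℝ))) * f (y - p) *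
        (starRingEnd ℂ) (g y)) = _
    rw [inner_smul_right]
    push_cast
    ring_nf
  refine ⟨hH.integral_prod_right.congr e, ?_⟩
  rw [hT, ← integral_congr_ae e, ← integral_integral_swap hH]
  refine integral_congr_ae (Eventually.of_forall fun x => ?_)
  simp only [inner_schrodinger, integral_const_mul]

/-- Taking for `g` the indicators of sets of finite measure turns the weak identity into equality of
all set integrals. -/
theorem IsFourierIntegral.coeFn_apply {u : L2H d} (hu : Integrable u) {l : ℝ}
    {T : L2R d →L[ℂ] L2R d} (hT : IsFourierIntegral u l T) (f : L2R d) :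
    T f =ᵐ[volume] fun y => ∫ p, f (y - p) * schrodingerKernel u l (l • y) p := by
  have key : ∀ (s : Set (EuclideanSpace ℝ (Fin d))) (hs : MeasurableSet s) (hμ : volume s < ∞),
      (fun y => (starRingEnd ℂ) ((indicatorConstLp 2 hs hμ.ne (1 : ℂ)) y) *
        ∫ p, f (y - p) * schrodingerKernel u l (l • y) p) =ᵐ[volume]
      s.indicator fun y => ∫ p, f (y - p) * schrodingerKernel u l (l • y) p := by
    intro s hs hμ
    filter_upwards [indicatorConstLp_coeFn (p := 2) (hs := hs) (hμs := hμ.ne) (c := (1 : ℂ))]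
      with y hy
    rw [hy]
    by_cases hys : y ∈ s <;> simp [hys]
  refine ae_eq_of_forall_setIntegral_eq_of_sigmaFinite (fun s hs hμ => ?_) (fun s hs hμ => ?_)
    fun s hs hμ => ?_
  · exact integrableOn_Lp_of_measure_ne_top (T f) (by norm_num) hμ.ne
  · rw [← integrable_indicator_iff hs]
    exact (hT.inner_eq hu f (indicatorConstLp 2 hs hμ.ne 1)).1.congr (key s hs hμ)
  · rw [← integral_indicator hs, ← integral_indicator hs, ← integral_congr_ae (key s hs hμ),
      ← (hT.inner_eq hu f (indicatorConstLp 2 hs hμ.ne 1)).2, integral_indicator hs,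
      L2.inner_indicatorConstLp_one]

/-- For almost every `y`, `f ↦ T f (y)` is the inner product with the vector `z ↦ conj k(l y, y -
z)`, which `hk` places in `L²`. Summing over the basis under the `y`-integral, Parseval returns the
squared norm of that vector. -/
theorem IsFourierIntegral.hsNormSq_eq {u : L2H d} (hu : Integrable u) {l : ℝ}
    {T : L2R d →L[ℂ] L2R d} (hT : IsFourierIntegral u l T)
    (hk : ∀ᵐ y, ∫⁻ p, ‖schrodingerKernel u l (l • y) p‖ₑ ^ 2 < ∞) :
    hsNormSq T = ∫⁻ y, ∫⁻ p, ‖schrodingerKernel u l (l • y) p‖ₑ ^ 2 := by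
  have hm : StronglyMeasurable fun z : EuclideanSpace ℝ (Fin d) × EuclideanSpace ℝ (Fin d) =>
      schrodingerKernel u l (l • z.1) z.2 :=
    (stronglyMeasurable_schrodingerKernel u).comp_measurable
      (g := fun z : EuclideanSpace ℝ (Fin d) × EuclideanSpace ℝ (Fin d) => (l, l • z.1, z.2))
      (by fun_prop)
  have e : ∀ f : L2R d, ‖T f‖ₑ ^ 2 =
      ∫⁻ y, ‖∫ p, f (y - p) * schrodingerKernel u l (l • y) p‖ₑ ^ 2 := fun f => by
    rw [← Lp.lintegral_enorm_sq]
    refine lintegral_congr_ae ?_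
    filter_upwards [hT.coeFn_apply hu f] with y hy
    rw [hy]
  unfold hsNormSq
  simp_rw [e]
  rw [← lintegral_tsum]
  swap
  · intro i
    refine (StronglyMeasurable.integral_prod_right (f := fun y p =>
      onb (L2R d) i (y - p) * schrodingerKernel u l (l • y) p) ?_).enorm.pow_const 2 |>.aemeasurable
    exact ((Lp.stronglyMeasurable (onb (L2R d) i)).comp_measurable (g := fun z :
      EuclideanSpace ℝ (Fin d) × EuclideanSpace ℝ (Fin d) => z.1 - z.2) (by fun_prop)).mul hm
  refine lintegral_congr_ae ?_
  filter_upwards [hk] with y hy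
  have hv : MemLp (fun z => (starRingEnd ℂ) (schrodingerKernel u l (l • y) (y - z))) 2 volume := by
    refine ⟨(RCLike.continuous_conj.comp_stronglyMeasurable (hm.comp_measurable
      (g := fun z => (y, y - z)) (by fun_prop))).aestronglyMeasurable, ?_⟩
    rw [eLpNorm_lt_top_iff_lintegral_rpow_enorm_lt_top (by norm_num) (by norm_num)]
    simp only [RCLike.enorm_conj, ENNReal.toReal_ofNat, ENNReal.rpow_two]
    rwa [lintegral_sub_left_eq_self (fun z => ‖schrodingerKernel u l (l • y) z‖ₑ ^ 2)]
  have h1 : ∀ f : L2R d, ∫ p, f (y - p) * schrodingerKernel u l (l • y) p =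
      inner ℂ hv.toLp f := fun f => by
    rw [L2.inner_def, ← integral_sub_left_eq_self _ _ y]
    refine integral_congr_ae ?_
    filter_upwards [hv.coeFn_toLp] with z hz
    rw [hz, RCLike.inner_apply]
    simp
  simp_rw [h1]
  have h2 : ∀ f : L2R d, ‖inner ℂ hv.toLp f‖ₑ = ‖inner ℂ f hv.toLp‖ₑ := fun f => by
    rw [← inner_conj_symm, RCLike.enorm_conj]
  simp_rw [h2]
  rw [(onb (L2R d)).tsum_enorm_inner_sq, ← Lp.lintegral_enorm_sq,
    ← lintegral_sub_left_eq_self (fun z => ‖schrodingerKernel u l (l • y) z‖ₑ ^ 2) y]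
  refine lintegral_congr_ae ?_
  filter_upwards [hv.coeFn_toLp] with z hz
  rw [hz, RCLike.enorm_conj]

end Kernel

/-! ### Plancherel on `L¹ ∩ L²` and the norm of operator fields -/

section FieldNorm

variable {d : ℕ}

/-- By Tonelli the `p`-integral goes outside. Almost every slice of `u` at fixed `p` lies in `L¹ ∩
L²`, where Plancherel in `(q, t)` applies. -/
theorem lintegral_enorm_schrodingerKernel_sq {u : L2H d} (hu : Integrable u) :
    ∫⁻ l : ℝ, ∫⁻ η, ∫⁻ p, ‖schrodingerKernel u l η p‖ₑ ^ 2 = ‖u‖ₑ ^ 2 := by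
  have hm : Measurable fun z : ℝ × EuclideanSpace ℝ (Fin d) × EuclideanSpace ℝ (Fin d) =>
      ‖schrodingerKernel u z.1 z.2.1 z.2.2‖ₑ ^ 2 :=
    (stronglyMeasurable_schrodingerKernel u).enorm.pow_const 2
  have hm' : Measurable fun z : (EuclideanSpace ℝ (Fin d) × ℝ) × EuclideanSpace ℝ (Fin d) =>
      ‖schrodingerKernel u z.1.2 z.1.1 z.2‖ₑ ^ 2 := by
    exact hm.comp (g := fun z : ℝ × EuclideanSpace ℝ (Fin d) × EuclideanSpace ℝ (Fin d) =>
      ‖schrodingerKernel u z.1 z.2.1 z.2.2‖ₑ ^ 2)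
      (f := fun z : (EuclideanSpace ℝ (Fin d) × ℝ) × EuclideanSpace ℝ (Fin d) =>
        (z.1.2, z.1.1, z.2)) (by fun_prop)
  have hum : StronglyMeasurable
      (fun z : EuclideanSpace ℝ (Fin d) × EuclideanSpace ℝ (Fin d) × ℝ => u z) :=
    Lp.stronglyMeasurable u
  have hu2 : ∫⁻ p, ∫⁻ w : EuclideanSpace ℝ (Fin d) × ℝ, ‖u (Heis.mk p w.1 w.2)‖ₑ ^ 2 =
      ‖u‖ₑ ^ 2 := by
    rw [← Lp.lintegral_enorm_sq]
    exact (lintegral_prod (μ := (volume : Measure (EuclideanSpace ℝ (Fin d))))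
      (ν := (volume : Measure (EuclideanSpace ℝ (Fin d) × ℝ)))
      (fun z : EuclideanSpace ℝ (Fin d) × EuclideanSpace ℝ (Fin d) × ℝ => ‖u z‖ₑ ^ 2)
      (hum.enorm.pow_const 2).aemeasurable).symm
  have hms : Measurable fun p => ∫⁻ w : EuclideanSpace ℝ (Fin d) × ℝ,
      ‖u (Heis.mk p w.1 w.2)‖ₑ ^ 2 :=
    Measurable.lintegral_prod_right (f := fun p (w : EuclideanSpace ℝ (Fin d) × ℝ) =>
      ‖u (Heis.mk p w.1 w.2)‖ₑ ^ 2) (hum.enorm.pow_const 2)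
  have hfin : ∀ᵐ p, ∫⁻ w : EuclideanSpace ℝ (Fin d) × ℝ, ‖u (Heis.mk p w.1 w.2)‖ₑ ^ 2 < ∞ :=
    ae_lt_top hms (by rw [hu2]; simp)
  have hslice : ∀ᵐ p, Integrable
      (fun w : EuclideanSpace ℝ (Fin d) × ℝ => u (Heis.mk p w.1 w.2)) :=
    Integrable.prod_right_ae (μ := (volume : Measure (EuclideanSpace ℝ (Fin d))))
      (ν := (volume : Measure (EuclideanSpace ℝ (Fin d) × ℝ)))
      (f := fun z : EuclideanSpace ℝ (Fin d) × EuclideanSpace ℝ (Fin d) × ℝ => u z) hu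
  rw [lintegral_lintegral_swap]
  swap
  · exact (Measurable.lintegral_prod_right (f := fun (z : ℝ × EuclideanSpace ℝ (Fin d)) p =>
      ‖schrodingerKernel u z.1 z.2 p‖ₑ ^ 2) (hm.comp (f := fun z : (ℝ × EuclideanSpace ℝ (Fin d)) ×
        EuclideanSpace ℝ (Fin d) => (z.1.1, z.1.2, z.2)) (by fun_prop))).aemeasurable
  have hm2 : Measurable fun ξ : EuclideanSpace ℝ (Fin d) × ℝ =>
      ∫⁻ p, ‖schrodingerKernel u ξ.2 ξ.1 p‖ₑ ^ 2 :=
    Measurable.lintegral_prod_right (f := fun (ξ : EuclideanSpace ℝ (Fin d) × ℝ) p =>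
      ‖schrodingerKernel u ξ.2 ξ.1 p‖ₑ ^ 2) hm'
  rw [← lintegral_prod (fun ξ : EuclideanSpace ℝ (Fin d) × ℝ =>
    ∫⁻ p, ‖schrodingerKernel u ξ.2 ξ.1 p‖ₑ ^ 2) hm2.aemeasurable,
    lintegral_lintegral_swap hm'.aemeasurable, ← hu2]
  refine lintegral_congr_ae ?_
  filter_upwards [hfin, hslice] with p h1 h2
  refine lintegral_enorm_centralFourier_sq h2 ⟨h2.1, ?_⟩
  rw [eLpNorm_lt_top_iff_lintegral_rpow_enorm_lt_top (by norm_num) (by norm_num)]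
  simpa using h1

/-- The Plancherel weight is exactly the Jacobian of `y ↦ l y` on `ℝᵈ`. -/
theorem lintegral_comp_smul_mul {X : EuclideanSpace ℝ (Fin d) → ℝ≥0∞} (hX : Measurable X)
    {l : ℝ} (hl : l ≠ 0) : (∫⁻ y, X (l • y)) * ENNReal.ofReal (|l| ^ d) = ∫⁻ η, X η := by
  have h := Measure.map_addHaar_smul (volume : Measure (EuclideanSpace ℝ (Fin d))) hl
  rw [← lintegral_map hX (by fun_prop), h, lintegral_smul_measure, finrank_euclideanSpace_fin,
    smul_eq_mul, mul_comm, ← mul_assoc, ← ENNReal.ofReal_mul (by positivity), abs_inv, abs_pow,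
    mul_inv_cancel₀ (by positivity), ENNReal.ofReal_one, one_mul]

theorem ae_ne_zero_real : ∀ᵐ l : ℝ, l ≠ 0 := by
  simp [ae_iff]

/-- Plancherel's identity on `L¹ ∩ L²`. -/
theorem lintegral_hsNormSq_of_isFourierIntegral {u : L2H d} (hu : Integrable u)
    {T : ℝ → L2R d →L[ℂ] L2R d} (hT : ∀ l, IsFourierIntegral u l (T l)) :
    ∫⁻ l, hsNormSq (T l) * ENNReal.ofReal (|l| ^ d) = ‖u‖ₑ ^ 2 := by
  have hm : Measurable fun z : ℝ × EuclideanSpace ℝ (Fin d) =>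
      ∫⁻ p, ‖schrodingerKernel u z.1 z.2 p‖ₑ ^ 2 :=
    Measurable.lintegral_prod_right (f := fun (z : ℝ × EuclideanSpace ℝ (Fin d)) p =>
      ‖schrodingerKernel u z.1 z.2 p‖ₑ ^ 2)
      (((stronglyMeasurable_schrodingerKernel u).enorm.pow_const 2).comp
        (f := fun z : (ℝ × EuclideanSpace ℝ (Fin d)) × EuclideanSpace ℝ (Fin d) =>
          (z.1.1, z.1.2, z.2)) (by fun_prop))
  have hml : ∀ l : ℝ, Measurable fun η => ∫⁻ p, ‖schrodingerKernel u l η p‖ₑ ^ 2 := fun l =>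
    hm.comp (f := fun η => (l, η)) (by fun_prop)
  rw [← lintegral_enorm_schrodingerKernel_sq hu]
  have hfin : ∀ᵐ l : ℝ, ∫⁻ η, ∫⁻ p, ‖schrodingerKernel u l η p‖ₑ ^ 2 < ∞ :=
    ae_lt_top (Measurable.lintegral_prod_right (f := fun (l : ℝ) η =>
      ∫⁻ p, ‖schrodingerKernel u l η p‖ₑ ^ 2) hm)
      (by rw [lintegral_enorm_schrodingerKernel_sq hu]; simp)
  refine lintegral_congr_ae ?_
  filter_upwards [hfin, ae_ne_zero_real] with l hl hl0
  have e := lintegral_comp_smul_mul (hml l) hl0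
  rw [← e]
  rw [← e] at hl
  rw [(hT l).hsNormSq_eq hu]
  -- The finiteness required by `hsNormSq_eq`: an infinite `y`-integral would stay infinite after
  -- multiplication by the positive weight, against `hl`.
  refine ae_lt_top ((hml l).comp (measurable_const_smul l)) fun h => ?_
  rw [h, ENNReal.top_mul (by positivity)] at hl
  exact lt_irrefl _ hl

/-- Weak measurability of a field of operators. -/
def WeaklyAEMeasurable (F : ℝ → L2R d →L[ℂ] L2R d) : Prop :=
  ∀ f g : L2R d, AEMeasurable (fun l => inner ℂ g (F l f)) volume

/-- The squared norm of a field of operators for the Plancherel measure `|l|ᵈ dl`. -/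
def fieldNormSq (F : ℝ → L2R d →L[ℂ] L2R d) : ℝ≥0∞ :=
  ∫⁻ l, hsNormSq (F l) * ENNReal.ofReal (|l| ^ d)

theorem WeaklyAEMeasurable.add {F G : ℝ → L2R d →L[ℂ] L2R d} (hF : WeaklyAEMeasurable F)
    (hG : WeaklyAEMeasurable G) : WeaklyAEMeasurable (F + G) := fun f g => by
  simp only [Pi.add_apply, add_apply, inner_add_right]
  exact (hF f g).add (hG f g)

theorem WeaklyAEMeasurable.smul {F : ℝ → L2R d →L[ℂ] L2R d} (hF : WeaklyAEMeasurable F)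
    {c : ℝ → ℂ} (hc : Measurable c) : WeaklyAEMeasurable fun l => c l • F l := fun f g => by
  simp only [smul_apply, inner_smul_right]
  exact hc.aemeasurable.mul (hF f g)

theorem WeaklyAEMeasurable.neg {F : ℝ → L2R d →L[ℂ] L2R d} (hF : WeaklyAEMeasurable F) :
    WeaklyAEMeasurable (-F) := fun f g => by
  simp only [Pi.neg_apply, neg_apply, inner_neg_right]
  exact (hF f g).neg

theorem WeaklyAEMeasurable.sub {F G : ℝ → L2R d →L[ℂ] L2R d} (hF : WeaklyAEMeasurable F)
    (hG : WeaklyAEMeasurable G) : WeaklyAEMeasurable (F - G) := by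
  rw [sub_eq_add_neg]; exact hF.add hG.neg

theorem WeaklyAEMeasurable.aemeasurable_hsNormSq_mul {F : ℝ → L2R d →L[ℂ] L2R d}
    (hF : WeaklyAEMeasurable F) :
    AEMeasurable fun l => hsNormSq (F l) * ENNReal.ofReal (|l| ^ d) :=
  (aemeasurable_hsNormSq hF).mul (by fun_prop)

/-- Minkowski is used twice, for the Hilbert–Schmidt norm at each `l` and then for `L²(dl)`, with
the square root of the weight absorbed into the functions. -/
theorem sqrt_fieldNormSq_add_le {F G : ℝ → L2R d →L[ℂ] L2R d} (hF : WeaklyAEMeasurable F)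
    (hG : WeaklyAEMeasurable G) :
    fieldNormSq (F + G) ^ (1 / 2 : ℝ) ≤
      fieldNormSq F ^ (1 / 2 : ℝ) + fieldNormSq G ^ (1 / 2 : ℝ) := by
  have sq : ∀ a : ℝ≥0∞, (a ^ (1 / 2 : ℝ)) ^ (2 : ℝ) = a := fun a => by
    rw [← ENNReal.rpow_mul]; norm_num
  have h := ENNReal.lintegral_Lp_add_le (μ := (volume : Measure ℝ)) (p := 2)
    (f := fun l => (hsNormSq (F l) * ENNReal.ofReal (|l| ^ d)) ^ (1 / 2 : ℝ))
    (g := fun l => (hsNormSq (G l) * ENNReal.ofReal (|l| ^ d)) ^ (1 / 2 : ℝ))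
    (hF.aemeasurable_hsNormSq_mul.pow_const _) (hG.aemeasurable_hsNormSq_mul.pow_const _)
    (by norm_num)
  simp only [sq] at h
  refine le_trans (ENNReal.rpow_le_rpow (lintegral_mono fun l => ?_) (by norm_num)) h
  rw [← sq (hsNormSq ((F + G) l) * _)]
  refine ENNReal.rpow_le_rpow ?_ (by norm_num)
  simp only [Pi.add_apply, ENNReal.mul_rpow_of_nonneg _ _ (by norm_num : (0 : ℝ) ≤ 1 / 2),
    ← add_mul]
  gcongr
  exact sqrt_hsNormSq_add_le _ _

theorem fieldNormSq_neg (F : ℝ → L2R d →L[ℂ] L2R d) : fieldNormSq (-F) = fieldNormSq F := by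
  simp [fieldNormSq, hsNormSq_neg]

theorem fieldNormSq_smul (c : ℂ) (F : ℝ → L2R d →L[ℂ] L2R d) :
    fieldNormSq (c • F) = ‖c‖ₑ ^ 2 * fieldNormSq F := by
  simp only [fieldNormSq, Pi.smul_apply, hsNormSq_smul, mul_assoc]
  exact lintegral_const_mul' _ _ (by simp)

theorem ENNReal.tendsto_rpow_half_zero_iff {ι : Type*} {x : Filter ι} {a : ι → ℝ≥0∞} :
    Tendsto (fun i => a i ^ (1 / 2 : ℝ)) x (𝓝 0) ↔ Tendsto a x (𝓝 0) := by
  constructor <;> intro h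
  · have := (ENNReal.continuous_rpow_const (y := 2)).tendsto 0 |>.comp h
    simp only [Function.comp_def, ← ENNReal.rpow_mul] at this
    norm_num at this
    simpa using this
  · have := (ENNReal.continuous_rpow_const (y := 1 / 2)).tendsto 0 |>.comp h
    simpa [Function.comp_def] using this

end FieldNorm

/-! ### Plancherel on `L²(ℍᵈ)` and central translations -/

section GroupFourier

variable {d : ℕ}

theorem Lp.integrable_add {α : Type*} [MeasurableSpace α] {μ : Measure α} {u v : Lp ℂ 2 μ}
    (hu : Integrable u μ) (hv : Integrable v μ) :
    Integrable (u + v : Lp ℂ 2 μ) μ :=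
  (hu.add hv).congr (Lp.coeFn_add u v).symm

theorem Lp.integrable_smul {α : Type*} [MeasurableSpace α] {μ : Measure α} {u : Lp ℂ 2 μ}
    (c : ℂ) (hu : Integrable u μ) : Integrable (c • u : Lp ℂ 2 μ) μ :=
  (hu.smul c).congr (Lp.coeFn_smul c u).symm

theorem IsGroupFourier.weaklyAEMeasurable {φ : L2H d} {F : ℝ → L2R d →L[ℂ] L2R d}
    (h : IsGroupFourier φ F) : WeaklyAEMeasurable F := h.1

theorem IsGroupFourier.add {φ ψ : L2H d} {F G : ℝ → L2R d →L[ℂ] L2R d}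
    (hF : IsGroupFourier φ F) (hG : IsGroupFourier ψ G) : IsGroupFourier (φ + ψ) (F + G) := by
  refine ⟨hF.weaklyAEMeasurable.add hG.weaklyAEMeasurable, ?_⟩
  obtain ⟨mF, u, S, hu, hS, hφ, hFS⟩ := hF
  obtain ⟨mG, v, T, hv, hT, hψ, hGT⟩ := hG
  refine ⟨fun n => u n + v n, fun n => S n + T n, fun n => Lp.integrable_add (hu n) (hv n),
    fun n l => (hS n l).add (hu n) (hv n) (hT n l), hφ.add hψ, ?_⟩
  change Tendsto (fun n => fieldNormSq (F + G - (S n + T n))) atTop (𝓝 0)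
  rw [← ENNReal.tendsto_rpow_half_zero_iff]
  have h1 := ENNReal.tendsto_rpow_half_zero_iff.2 hFS
  have h2 := ENNReal.tendsto_rpow_half_zero_iff.2 hGT
  have h3 := h1.add h2
  rw [add_zero] at h3
  refine tendsto_of_tendsto_of_tendsto_of_le_of_le tendsto_const_nhds h3 (fun n => zero_le)
    fun n => ?_
  rw [add_sub_add_comm]
  exact sqrt_fieldNormSq_add_le
    (WeaklyAEMeasurable.sub mF (IsFourierIntegral.aemeasurable (hS n)))
    (WeaklyAEMeasurable.sub mG (IsFourierIntegral.aemeasurable (hT n)))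

theorem IsGroupFourier.smul {φ : L2H d} {F : ℝ → L2R d →L[ℂ] L2R d} (c : ℂ)
    (hF : IsGroupFourier φ F) : IsGroupFourier (c • φ) (c • F) := by
  refine ⟨hF.weaklyAEMeasurable.smul (c := fun _ => c) measurable_const, ?_⟩
  obtain ⟨mF, u, S, hu, hS, hφ, hFS⟩ := hF
  refine ⟨fun n => c • u n, fun n => c • S n, fun n => Lp.integrable_smul c (hu n),
    fun n l => (hS n l).smul c, hφ.const_smul c, ?_⟩
  change Tendsto (fun n => fieldNormSq (c • F - c • S n)) atTop (𝓝 0)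
  simp_rw [← smul_sub, fieldNormSq_smul]
  have h3 := ENNReal.Tendsto.const_mul (a := ‖c‖ₑ ^ 2) hFS (Or.inr (by simp))
  rw [mul_zero] at h3
  exact h3

theorem IsGroupFourier.sub {φ ψ : L2H d} {F G : ℝ → L2R d →L[ℂ] L2R d}
    (hF : IsGroupFourier φ F) (hG : IsGroupFourier ψ G) : IsGroupFourier (φ - ψ) (F - G) := by
  have := hF.add (hG.smul (-1))
  simpa [sub_eq_add_neg] using this

/-- Plancherel's identity. -/
theorem IsGroupFourier.fieldNormSq_eq {φ : L2H d} {F : ℝ → L2R d →L[ℂ] L2R d}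
    (h : IsGroupFourier φ F) : fieldNormSq F = ‖φ‖ₑ ^ 2 := by
  obtain ⟨mF, u, T, hu, hT, hφ, hFT⟩ := h
  have sq : ∀ a : ℝ≥0∞, (a ^ 2) ^ (1 / 2 : ℝ) = a := fun a => by
    rw [← ENNReal.rpow_two, ← ENNReal.rpow_mul]; norm_num
  have mT : ∀ n, WeaklyAEMeasurable (T n) := fun n => IsFourierIntegral.aemeasurable (hT n)
  have hN : ∀ n, fieldNormSq (T n) = ‖u n‖ₑ ^ 2 := fun n =>
    lintegral_hsNormSq_of_isFourierIntegral (hu n) (hT n)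
  have h0 : Tendsto (fun n => fieldNormSq (F - T n) ^ (1 / 2 : ℝ)) atTop (𝓝 0) :=
    ENNReal.tendsto_rpow_half_zero_iff.2 hFT
  have h1 : Tendsto (fun n => ‖u n‖ₑ) atTop (𝓝 ‖φ‖ₑ) := (continuous_enorm.tendsto _).comp hφ
  -- The triangle inequality through the approximants `T n`, in both directions; in `[0, ∞]` it
  -- needs no prior finiteness of the norm of `F`.
  have key : fieldNormSq F ^ (1 / 2 : ℝ) = ‖φ‖ₑ := by
    refine le_antisymm ?_ ?_
    · refine ge_of_tendsto' (b := fieldNormSq F ^ (1 / 2 : ℝ))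
        (by simpa only [zero_add] using h0.add h1) fun n => ?_
      have := sqrt_fieldNormSq_add_le (WeaklyAEMeasurable.sub mF (mT n)) (mT n)
      rwa [sub_add_cancel, hN, sq] at this
    · refine le_of_tendsto_of_tendsto' h1
        (by simpa only [zero_add] using h0.add_const (fieldNormSq F ^ (1 / 2 : ℝ))) fun n => ?_
      have := sqrt_fieldNormSq_add_le (WeaklyAEMeasurable.sub mF (mT n)).neg mF
      rwa [neg_sub, sub_add_cancel, hN, sq, ← neg_sub F, fieldNormSq_neg] at this
  rw [← key, ← ENNReal.rpow_two, ← ENNReal.rpow_mul]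
  norm_num

theorem IsGroupFourier.lintegral_ne_top {φ : L2H d} {F : ℝ → L2R d →L[ℂ] L2R d}
    (h : IsGroupFourier φ F) : ∫⁻ l, hsNormSq (F l) * ENNReal.ofReal (|l| ^ d) ≠ ∞ := by
  have := h.fieldNormSq_eq
  rw [fieldNormSq] at this
  rw [this]
  simp

theorem ae_ne_top_of_mul_abs_pow {X : ℝ → ℝ≥0∞}
    (hX : AEMeasurable fun l => X l * ENNReal.ofReal (|l| ^ d))
    (h : ∫⁻ l, X l * ENNReal.ofReal (|l| ^ d) ≠ ∞) : ∀ᵐ l, X l ≠ ∞ := by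
  filter_upwards [ae_lt_top' hX h, ae_ne_zero_real] with l hl hl0 hX
  rw [hX, ENNReal.top_mul (by positivity)] at hl
  exact lt_irrefl _ hl

theorem IsGroupFourier.ae_hsNormSq_ne_top {φ : L2H d} {F : ℝ → L2R d →L[ℂ] L2R d}
    (h : IsGroupFourier φ F) : ∀ᵐ l, hsNormSq (F l) ≠ ∞ :=
  ae_ne_top_of_mul_abs_pow h.weaklyAEMeasurable.aemeasurable_hsNormSq_mul h.lintegral_ne_top

theorem IsGroupFourier.integrable {φ : L2H d} {F : ℝ → L2R d →L[ℂ] L2R d}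
    (h : IsGroupFourier φ F) : Integrable fun l => (hsNormSq (F l)).toReal * |l| ^ d := by
  have := integrable_toReal_of_lintegral_ne_top
    h.weaklyAEMeasurable.aemeasurable_hsNormSq_mul h.lintegral_ne_top
  refine this.congr (Eventually.of_forall fun l => ?_)
  simp [ENNReal.toReal_mul, ENNReal.toReal_ofReal]

theorem IsGroupFourier.integral_eq {φ : L2H d} {F : ℝ → L2R d →L[ℂ] L2R d}
    (h : IsGroupFourier φ F) : ∫ l, (hsNormSq (F l)).toReal * |l| ^ d = ‖φ‖ ^ 2 := by
  have e := h.fieldNormSq_eq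
  rw [fieldNormSq] at e
  have := integral_toReal h.weaklyAEMeasurable.aemeasurable_hsNormSq_mul
    (ae_lt_top' h.weaklyAEMeasurable.aemeasurable_hsNormSq_mul h.lintegral_ne_top)
  rw [e] at this
  simpa [ENNReal.toReal_mul, ENNReal.toReal_ofReal] using this

theorem integral_polarization {α : Type*} [MeasurableSpace α] {μ : Measure α} {a b c e : α → ℝ}
    (ha : Integrable a μ) (hb : Integrable b μ) (hc : Integrable c μ) (he : Integrable e μ) :
    Integrable (fun l => ((a l : ℂ) - (b l : ℂ) + ((c l : ℂ) - (e l : ℂ)) * Complex.I) / 4) μ ∧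
      ∫ l, ((a l : ℂ) - (b l : ℂ) + ((c l : ℂ) - (e l : ℂ)) * Complex.I) / 4 ∂μ =
        (((∫ l, a l ∂μ : ℝ) : ℂ) - ((∫ l, b l ∂μ : ℝ) : ℂ) +
          (((∫ l, c l ∂μ : ℝ) : ℂ) - ((∫ l, e l ∂μ : ℝ) : ℂ)) * Complex.I) / 4 := by
  have ha' : Integrable (fun l => (a l : ℂ)) μ := ha.ofReal
  have hb' : Integrable (fun l => (b l : ℂ)) μ := hb.ofReal
  have hc' : Integrable (fun l => (c l : ℂ)) μ := hc.ofReal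
  have he' : Integrable (fun l => (e l : ℂ)) μ := he.ofReal
  have i1 : Integrable (fun l => (a l : ℂ) - (b l : ℂ)) μ := ha'.sub hb'
  have i2 : Integrable (fun l => ((c l : ℂ) - (e l : ℂ)) * Complex.I) μ :=
    (hc'.sub he').mul_const _
  refine ⟨(i1.add i2).div_const 4, ?_⟩
  rw [integral_div, integral_add i1 i2, integral_mul_const, integral_sub ha' hb',
    integral_sub hc' he']
  simp only [integral_complex_ofReal]

/-- The polarized Plancherel identity. -/
theorem IsGroupFourier.integral_hsInner {φ ψ : L2H d} {F G : ℝ → L2R d →L[ℂ] L2R d}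
    (hF : IsGroupFourier φ F) (hG : IsGroupFourier ψ G) :
    Integrable (fun l => hsInner (F l) (G l) * ((|l| ^ d : ℝ) : ℂ)) ∧
      ∫ l, hsInner (F l) (G l) * ((|l| ^ d : ℝ) : ℂ) = inner ℂ ψ φ := by
  have h1 := hF.add hG
  have h2 := hF.sub hG
  have h3 := hF.add (hG.smul Complex.I)
  have h4 := hF.sub (hG.smul Complex.I)
  have e : (fun l => hsInner (F l) (G l) * ((|l| ^ d : ℝ) : ℂ)) =ᵐ[volume] fun l =>
      ((((hsNormSq ((F + G) l)).toReal * |l| ^ d : ℝ) : ℂ) -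
        (((hsNormSq ((F - G) l)).toReal * |l| ^ d : ℝ) : ℂ) +
      ((((hsNormSq ((F + Complex.I • G) l)).toReal * |l| ^ d : ℝ) : ℂ) -
        (((hsNormSq ((F - Complex.I • G) l)).toReal * |l| ^ d : ℝ) : ℂ)) * Complex.I) / 4 := by
    filter_upwards [hF.ae_hsNormSq_ne_top, hG.ae_hsNormSq_ne_top] with l hl hl'
    rw [hsInner_eq_polarization hl hl']
    simp only [Pi.add_apply, Pi.sub_apply, Pi.smul_apply, Complex.ofReal_mul]
    ring
  obtain ⟨hi, he⟩ := integral_polarization h1.integrable h2.integrable h3.integrable h4.integrable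
  refine ⟨hi.congr e.symm, ?_⟩
  rw [integral_congr_ae e, he]
  rw [h1.integral_eq, h2.integral_eq, h3.integral_eq, h4.integral_eq,
    inner_eq_sum_norm_sq_div_four]
  -- The operator polarization involves `φ ± iψ` and that of `⟨ψ, φ⟩` involves `ψ ∓ iφ`; they differ
  -- by a unimodular factor.
  have n1 : ‖φ + Complex.I • ψ‖ = ‖ψ - Complex.I • φ‖ := by
    have : φ + Complex.I • ψ = Complex.I • (ψ - Complex.I • φ) := by
      rw [smul_sub, smul_smul, Complex.I_mul_I]; module
    rw [this, norm_smul]; simp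
  have n2 : ‖φ - Complex.I • ψ‖ = ‖ψ + Complex.I • φ‖ := by
    have : φ - Complex.I • ψ = -(Complex.I • (ψ + Complex.I • φ)) := by
      rw [smul_add, smul_smul, Complex.I_mul_I]; module
    rw [this, norm_neg, norm_smul]; simp
  rw [n1, n2, add_comm φ ψ, norm_sub_rev φ ψ]
  simp

theorem enorm_exp_two_pi_I (l t : ℝ) : ‖Complex.exp (2 * Real.pi * Complex.I * l * t)‖ₑ = 1 := by
  rw [← ofReal_norm]
  simp [Complex.norm_exp]

theorem coeFn_leftTranslate (g : Heis d) (u : L2H d) :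
    leftTranslate g u =ᵐ[volume] fun x => u (g⁻¹ * x) :=
  Lp.coeFn_compMeasurePreserving u (Heis.measurePreserving_mul_left g⁻¹)

theorem schrodinger_central_mul (l t : ℝ) (x : Heis d) (f : L2R d) :
    schrodinger l (Heis.mk 0 0 t * x) f =
      Complex.exp (2 * Real.pi * Complex.I * l * t) • schrodinger l x f := by
  refine Lp.ext ?_
  filter_upwards [coeFn_schrodinger l (Heis.mk 0 0 t * x) f, coeFn_schrodinger l x f,
    Lp.coeFn_smul (Complex.exp (2 * Real.pi * Complex.I * l * t)) (schrodinger l x f)]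
    with y h1 h2 h3
  rw [h1, h3, Pi.smul_apply, h2]
  simp only [schrodingerPhase, Heis.t_mul, Heis.q_mul, Heis.p_mul, Heis.t_mk, Heis.p_mk,
    Heis.q_mk, zero_add, inner_zero_left, add_zero, smul_eq_mul, Complex.ofReal_add, mul_add,
    Complex.exp_add]
  ring

theorem Heis.measurableEmbedding_mul_left (g : Heis d) :
    MeasurableEmbedding (fun x : Heis d => g * x) :=
  MeasurableEquiv.measurableEmbedding
    { toEquiv := Equiv.mulLeft g
      measurable_toFun := (Heis.measurePreserving_mul_left g).measurable
      measurable_invFun := (Heis.measurePreserving_mul_left g⁻¹).measurable }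

theorem integrable_leftTranslate {u : L2H d} (hu : Integrable u) (g : Heis d) :
    Integrable (leftTranslate g u) := by
  refine Integrable.congr ?_ (coeFn_leftTranslate g u).symm
  exact ((Heis.measurePreserving_mul_left g⁻¹).integrable_comp_emb
    (Heis.measurableEmbedding_mul_left g⁻¹)).2 hu

/-- Substitute `x ↦ (0,0,t) x`, which preserves the measure; the central element then leaves `Π_l`
as a scalar. -/
theorem IsFourierIntegral.leftTranslate_central {u : L2H d} {l : ℝ} {T : L2R d →L[ℂ] L2R d}
    (hT : IsFourierIntegral u l T) (t : ℝ) :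
    IsFourierIntegral (leftTranslate (Heis.mk 0 0 t) u) l
      (Complex.exp (2 * Real.pi * Complex.I * l * t) • T) := by
  intro f g
  rw [smul_apply, inner_smul_right, hT, ← integral_const_mul]
  have e : ∀ᵐ x, leftTranslate (Heis.mk 0 0 t) u x * inner ℂ g (schrodinger l x f) =
      u ((Heis.mk 0 0 t)⁻¹ * x) * inner ℂ g (schrodinger l x f) := by
    filter_upwards [coeFn_leftTranslate (Heis.mk 0 0 t) u] with x hx
    rw [hx]
  rw [integral_congr_ae e]
  refine Eq.trans ?_ ((Heis.measurePreserving_mul_left (Heis.mk 0 0 t)).integral_comp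
    (Heis.measurableEmbedding_mul_left _)
    (fun x => u ((Heis.mk 0 0 t)⁻¹ * x) * inner ℂ g (schrodinger l x f)))
  refine integral_congr_ae (Eventually.of_forall fun x => ?_)
  simp only [inv_mul_cancel_left, schrodinger_central_mul, inner_smul_right]
  ring

/-- The factor is unimodular, so translating the approximants of `φ` leaves the Hilbert–Schmidt
errors unchanged. -/
theorem IsGroupFourier.leftTranslate_central {φ : L2H d} {F : ℝ → L2R d →L[ℂ] L2R d}
    (hF : IsGroupFourier φ F) (t : ℝ) :
    IsGroupFourier (leftTranslate (Heis.mk 0 0 t) φ)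
      (fun l => Complex.exp (2 * Real.pi * Complex.I * l * t) • F l) := by
  refine ⟨hF.weaklyAEMeasurable.smul (by fun_prop), ?_⟩
  obtain ⟨mF, u, S, hu, hS, hφ, hFS⟩ := hF
  refine ⟨fun n => leftTranslate (Heis.mk 0 0 t) (u n),
    fun n l => Complex.exp (2 * Real.pi * Complex.I * l * t) • S n l,
    fun n => integrable_leftTranslate (hu n) _,
    fun n l => (hS n l).leftTranslate_central t,
    ((leftTranslate (Heis.mk 0 0 t)).continuous.tendsto _).comp hφ, ?_⟩
  simpa only [← smul_sub, hsNormSq_smul, enorm_exp_two_pi_I, one_pow, one_mul] using hFS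

end GroupFourier

/-! ### Existence of the group Fourier transform -/

section Existence

variable {d : ℕ}

/-- Simple functions are dense in `L²`, and a simple function in `L²` has support of finite measure,
hence is integrable. -/
theorem exists_integrable_norm_sub_le (φ : L2H d) {ε : ℝ} (hε : 0 < ε) :
    ∃ u : L2H d, Integrable u ∧ ‖φ - u‖ ≤ ε := by
  obtain ⟨u, hu, hd⟩ := Metric.mem_closure_iff.1
    (Lp.simpleFunc.dense (E := ℂ) (p := 2) (μ := (volume : Measure (Heis d))) (by norm_num) φ) ε hε
  refine ⟨u, ?_, by rw [← dist_eq_norm]; exact hd.le⟩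
  lift u to Lp.simpleFunc ℂ 2 (volume : Measure (Heis d)) using hu
  have h := (SimpleFunc.memLp_iff_integrable (by norm_num) (by norm_num)).1
    (Lp.simpleFunc.memLp u)
  exact h.congr (Lp.simpleFunc.toSimpleFunc_eq_toFun u)

/-- Each term is at most the sum `X`, so increments in operator norm are at most `√X · 2⁻ⁿ`. -/
theorem cauchySeq_of_tsum_hsNormSq_ne_top {E : Type*} [NormedAddCommGroup E]
    [InnerProductSpace ℂ E] [CompleteSpace E] {T : ℕ → E →L[ℂ] E}
    (h : ∑' n, 4 ^ n * hsNormSq (T (n + 1) - T n) ≠ ∞) : CauchySeq T := by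
  set X := ∑' n, 4 ^ n * hsNormSq (T (n + 1) - T n) with hX
  refine cauchySeq_of_le_geometric (1 / 2) (√X.toReal) (by norm_num) fun n => ?_
  have h1 : 4 ^ n * hsNormSq (T (n + 1) - T n) ≤ X := ENNReal.le_tsum n
  have h2 : hsNormSq (T (n + 1) - T n) ≠ ∞ := fun h2 => by
    rw [h2, ENNReal.mul_top (by positivity)] at h1
    exact h (top_le_iff.1 h1)
  have h3 := ENNReal.toReal_mono h h1
  simp only [ENNReal.toReal_mul, ENNReal.toReal_pow, ENNReal.toReal_ofNat] at h3
  rw [dist_comm, dist_eq_norm]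
  refine (norm_le_sqrt_hsNormSq _ h2).trans ?_
  have h4 : ((1 / 2 : ℝ) ^ n) = √((1 / 4) ^ n) := by
    rw [show (1 / 4 : ℝ) = (1 / 2) ^ 2 by norm_num, ← pow_mul, mul_comm, pow_mul,
      Real.sqrt_sq (by positivity)]
  rw [h4, ← Real.sqrt_mul ENNReal.toReal_nonneg]
  refine Real.sqrt_le_sqrt ?_
  rw [one_div, inv_pow, ← div_eq_mul_inv, le_div_iff₀ (by positivity)]
  linarith

/-- Every `φ ∈ L²(ℍᵈ)` has a group Fourier transform. -/
theorem exists_isGroupFourier (φ : L2H d) : ∃ F, IsGroupFourier φ F := by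
  -- With rate `8⁻ⁿ` the squared increments are at most `4 · 64⁻ⁿ`, still summable after the weight
  -- `4ⁿ` that forces convergence at almost every `l`.
  have h0 : ∀ n : ℕ, ∃ u : L2H d, Integrable u ∧ ‖φ - u‖ ≤ (1 / 8 : ℝ) ^ n := fun n =>
    exists_integrable_norm_sub_le φ (by positivity)
  choose u hu hun using h0
  choose T hT using fun n l => exists_isFourierIntegral (hu n) l
  have mT : ∀ n, WeaklyAEMeasurable (T n) := fun n => IsFourierIntegral.aemeasurable (hT n)
  have hlim : Tendsto u atTop (𝓝 φ) := by
    rw [tendsto_iff_norm_sub_tendsto_zero]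
    refine squeeze_zero (fun n => norm_nonneg _) (fun n => ?_)
      (tendsto_pow_atTop_nhds_zero_of_lt_one (r := (1 / 8 : ℝ)) (by norm_num) (by norm_num))
    rw [norm_sub_rev]
    exact hun n
  have hN : ∀ m n, fieldNormSq (T m - T n) = ‖u m - u n‖ₑ ^ 2 := fun m n => by
    have e : u m - u n = u m + (-1 : ℂ) • u n := by rw [neg_one_smul, sub_eq_add_neg]
    rw [e]
    refine lintegral_hsNormSq_of_isFourierIntegral
      (Lp.integrable_add (hu m) (Lp.integrable_smul _ (hu n))) fun l => ?_
    have := (hT m l).add (hu m) (Lp.integrable_smul (-1) (hu n)) ((hT n l).smul (-1))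
    rwa [neg_one_smul ℂ (T n l), ← sub_eq_add_neg] at this
  have mD : ∀ m n, AEMeasurable fun l =>
      hsNormSq (T m l - T n l) * ENNReal.ofReal (|l| ^ d) := fun m n =>
    ((mT m).sub (mT n)).aemeasurable_hsNormSq_mul
  have hsum : ∫⁻ l : ℝ, (∑' n, 4 ^ n * hsNormSq (T (n + 1) l - T n l)) *
      ENNReal.ofReal (|l| ^ d) ≠ ∞ := by
    simp_rw [← ENNReal.tsum_mul_right, mul_assoc]
    rw [lintegral_tsum fun n => (mD (n + 1) n).const_mul _]
    have e : ∀ n, ∫⁻ l : ℝ, 4 ^ n * (hsNormSq (T (n + 1) l - T n l) * ENNReal.ofReal (|l| ^ d)) ≤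
        ENNReal.ofReal (4 * (1 / 16) ^ n) := fun n => by
      rw [lintegral_const_mul' _ _ (by simp)]
      have h1 := hN (n + 1) n
      rw [fieldNormSq] at h1
      simp only [Pi.sub_apply] at h1
      rw [h1]
      have h2 : ‖u (n + 1) - u n‖ ≤ 2 * (1 / 8) ^ n := by
        have a1 := hun n
        have a2 := hun (n + 1)
        have a3 : (1 / 8 : ℝ) ^ (n + 1) ≤ (1 / 8) ^ n :=
          pow_le_pow_of_le_one (by norm_num) (by norm_num) (Nat.le_succ n)
        have a4 : u (n + 1) - u n = (φ - u n) - (φ - u (n + 1)) := by abel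
        rw [a4]
        refine (norm_sub_le _ _).trans ?_
        linarith
      have h3 : (4 : ℝ≥0∞) ^ n = ENNReal.ofReal (4 ^ n) := by
        rw [ENNReal.ofReal_pow (by norm_num)]; norm_num
      rw [← ofReal_norm, h3, ← ENNReal.ofReal_pow (norm_nonneg _),
        ← ENNReal.ofReal_mul (by positivity)]
      refine ENNReal.ofReal_le_ofReal ?_
      calc (4 : ℝ) ^ n * ‖u (n + 1) - u n‖ ^ 2 ≤ 4 ^ n * (2 * (1 / 8) ^ n) ^ 2 := by gcongr
        _ = 4 * (1 / 16) ^ n := by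
          rw [mul_pow, ← pow_mul, mul_comm n 2, pow_mul, mul_left_comm, ← mul_pow]
          norm_num
    refine ne_top_of_le_ne_top ?_ (ENNReal.tsum_le_tsum e)
    have hs : Summable fun n : ℕ => 4 * (1 / 16 : ℝ) ^ n :=
      (summable_geometric_of_lt_one (by norm_num) (by norm_num)).mul_left _
    rw [← ENNReal.ofReal_tsum_of_nonneg (fun n => by positivity) hs]
    exact ENNReal.ofReal_ne_top
  have msum : AEMeasurable fun l : ℝ => (∑' n, 4 ^ n * hsNormSq (T (n + 1) l - T n l)) *
      ENNReal.ofReal (|l| ^ d) := by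
    simp_rw [← ENNReal.tsum_mul_right, mul_assoc]
    exact AEMeasurable.tsum fun n => (mD (n + 1) n).const_mul _
  -- Where `T n l` does not converge `limUnder` is arbitrary, but such `l` form a null set.
  set F : ℝ → L2R d →L[ℂ] L2R d := fun l => limUnder atTop fun n => T n l with hF
  have hTF : ∀ᵐ l, Tendsto (fun n => T n l) atTop (𝓝 (F l)) := by
    filter_upwards [ae_ne_top_of_mul_abs_pow msum hsum] with l hl
    exact (cauchySeq_of_tsum_hsNormSq_ne_top hl).tendsto_limUnder
  refine ⟨F, fun f g => ?_, u, T, hu, hT, hlim, ?_⟩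
  · refine aemeasurable_of_tendsto_metrizable_ae' (fun n => mT n f g) ?_
    filter_upwards [hTF] with l hl
    exact ((innerSL ℂ g).continuous.tendsto _).comp
      (((ContinuousLinearMap.apply ℂ (L2R d) f).continuous.tendsto _).comp hl)
  · have key : ∀ n, ∫⁻ l : ℝ, hsNormSq (F l - T n l) * ENNReal.ofReal (|l| ^ d) ≤
        ‖φ - u n‖ₑ ^ 2 := fun n => by
      have hconv : Tendsto (fun m => ‖u m - u n‖ₑ ^ 2) atTop (𝓝 (‖φ - u n‖ₑ ^ 2)) :=
        ((ENNReal.continuous_pow 2).tendsto _).comp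
          ((continuous_enorm.tendsto _).comp (hlim.sub_const _))
      rw [← hconv.liminf_eq]
      simp_rw [← fun m => hN m n]
      -- Fatou in `m`, together with lower semicontinuity of the Hilbert–Schmidt norm as `T m l → F
      -- l`.
      refine le_trans (lintegral_mono_ae ?_) (lintegral_liminf_le' fun m => mD m n)
      filter_upwards [hTF] with l hl
      have h1 : hsNormSq (F l - T n l) ≤ liminf (fun m => hsNormSq (T m l - T n l)) atTop := by
        refine hsNormSq_le_liminf fun x => ?_
        exact ((ContinuousLinearMap.apply ℂ (L2R d) x).continuous.tendsto _).comp
          (hl.sub_const (T n l))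
      have h2 : Monotone fun a : ℝ≥0∞ => a * ENNReal.ofReal (|l| ^ d) := fun a b hab =>
        mul_le_mul' hab le_rfl
      refine (h2 h1).trans (h2.map_liminf_of_continuousAt _ ?_).le
      exact (ENNReal.continuous_mul_const ENNReal.ofReal_ne_top).continuousAt
    refine tendsto_of_tendsto_of_tendsto_of_le_of_le tendsto_const_nhds ?_ (fun n => zero_le) key
    have h3 := ((ENNReal.continuous_pow 2).tendsto _).comp
      ((continuous_enorm.tendsto _).comp (hlim.const_sub φ))
    simpa [Function.comp_def] using h3

theorem isGroupFourier_groupFourier (φ : L2H d) : IsGroupFourier φ (groupFourier φ) := by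
  rw [groupFourier, dif_pos (exists_isGroupFourier φ)]
  exact (exists_isGroupFourier φ).choose_spec

end Existence

/-! ### Uniqueness of Fourier coefficients and periodization -/

section FourierSeries

/-- Pairing with an integrable `f` is a bounded functional on continuous functions of the circle; it
kills the characters, whose span is dense. -/
theorem integral_mul_continuousMap_eq_zero {f : ℝ → ℂ} (hf : IntegrableOn f (Set.Ioc 0 1))
    (h : ∀ k : ℤ, ∫ x in Set.Ioc (0 : ℝ) 1,
      f x * Complex.exp (2 * Real.pi * Complex.I * x * k) = 0)
    (G : C(AddCircle (1 : ℝ), ℂ)) :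
    ∫ x in Set.Ioc (0 : ℝ) 1, f x * G (x : AddCircle (1 : ℝ)) = 0 := by
  have hG : ∀ G : C(AddCircle (1 : ℝ), ℂ),
      IntegrableOn (fun x : ℝ => f x * G (x : AddCircle (1 : ℝ))) (Set.Ioc 0 1) := fun G =>
    Integrable.mul_bdd (c := ‖G‖) hf
      (G.continuous.comp (AddCircle.continuous_mk' 1)).aestronglyMeasurable
      (Eventually.of_forall fun x => G.norm_coe_le_norm _)
  let L₀ : C(AddCircle (1 : ℝ), ℂ) →ₗ[ℂ] ℂ :=
    { toFun := fun G => ∫ x in Set.Ioc (0 : ℝ) 1, f x * G (x : AddCircle (1 : ℝ))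
      map_add' := fun G G' => by
        simp only [ContinuousMap.add_apply, mul_add]
        exact integral_add (hG G) (hG G')
      map_smul' := fun c G => by
        simp only [ContinuousMap.smul_apply, smul_eq_mul, RingHom.id_apply, ← integral_const_mul]
        congr 1; ext x; ring }
  let L := L₀.mkContinuous (∫ x in Set.Ioc (0 : ℝ) 1, ‖f x‖) fun G => by
    change ‖∫ x in Set.Ioc (0 : ℝ) 1, f x * G (x : AddCircle (1 : ℝ))‖ ≤ _
    rw [← integral_mul_const]
    refine norm_integral_le_of_norm_le (hf.norm.mul_const _) (Eventually.of_forall fun x => ?_)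
    rw [norm_mul]
    gcongr
    exact G.norm_coe_le_norm _
  have hle : (Submodule.span ℂ (Set.range (@fourier 1))).topologicalClosure ≤
      LinearMap.ker L.toLinearMap := by
    refine Submodule.topologicalClosure_minimal _ ?_ L.isClosed_ker
    rw [Submodule.span_le]
    rintro _ ⟨k, rfl⟩
    change ∫ x in Set.Ioc (0 : ℝ) 1, f x * fourier k (x : AddCircle (1 : ℝ)) = 0
    rw [← h k]
    congr 1
    ext x
    rw [fourier_coe_apply]
    congr 2
    push_cast
    ring
  rw [span_fourier_closure_eq_top] at hle
  exact hle (Submodule.mem_top (x := G))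

/-- An integrable function on `(0, 1]` with vanishing Fourier coefficients vanishes a.e. -/
theorem ae_eq_zero_of_forall_integral_mul_exp_eq_zero {f : ℝ → ℂ}
    (hf : IntegrableOn f (Set.Ioc 0 1))
    (h : ∀ k : ℤ, ∫ x in Set.Ioc (0 : ℝ) 1,
      f x * Complex.exp (2 * Real.pi * Complex.I * x * k) = 0) :
    ∀ᵐ x ∂(volume.restrict (Set.Ioc (0 : ℝ) 1)), f x = 0 := by
  have h1 : ∀ᵐ x, x ∈ Set.Ioo (0 : ℝ) 1 → f x = 0 := by
    refine isOpen_Ioo.ae_eq_zero_of_integral_contDiff_smul_eq_zero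
      (hf.mono_set Set.Ioo_subset_Ioc_self).locallyIntegrableOn fun g hg _ hgs => ?_
    have hg0 : ∀ x ∉ Set.Ioo (0 : ℝ) 1, g x = 0 := fun x hx =>
      image_eq_zero_of_notMem_tsupport fun hx' => hx (hgs hx')
    -- A test function supported in `(0, 1)` vanishes at both endpoints, so it descends to a
    -- continuous function on the circle.
    have hc : Continuous (AddCircle.liftIoc (1 : ℝ) 0 fun x => (g x : ℂ)) :=
      AddCircle.liftIoc_continuous (by simp [hg0 0, hg0 1])
        (Complex.continuous_ofReal.comp hg.continuous).continuousOn
    rw [← integral_mul_continuousMap_eq_zero hf h ⟨_, hc⟩, ← integral_indicator measurableSet_Ioc]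
    congr 1
    ext x
    by_cases hx : x ∈ Set.Ioc (0 : ℝ) 1
    · rw [Set.indicator_of_mem hx, ContinuousMap.coe_mk,
        AddCircle.liftIoc_coe_apply (by simpa using hx), mul_comm]
      simp
    · rw [Set.indicator_of_notMem hx, hg0 x fun hx' => hx (Set.Ioo_subset_Ioc_self hx'), zero_smul]
  rw [← restrict_Ioo_eq_restrict_Ioc, ae_restrict_iff' measurableSet_Ioo]
  exact h1

theorem integral_Ioc_exp_two_pi (k : ℤ) :
    ∫ x in Set.Ioc (0 : ℝ) 1, Complex.exp (2 * Real.pi * Complex.I * x * k) =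
      if k = 0 then 1 else 0 := by
  rw [← intervalIntegral.integral_of_le zero_le_one]
  split_ifs with hk
  · simp [hk]
  · have hc : (2 * Real.pi * Complex.I * k : ℂ) ≠ 0 := by
      have : (k : ℂ) ≠ 0 := by exact_mod_cast hk
      have := Complex.two_pi_I_ne_zero
      positivity
    have e : ∀ x : ℝ, (2 * Real.pi * Complex.I * x * k : ℂ) = 2 * Real.pi * Complex.I * k * x :=
      fun x => by ring
    simp_rw [e]
    rw [integral_exp_mul_complex hc]
    have h1 := Complex.exp_int_mul_two_pi_mul_I k
    rw [show (2 * Real.pi * Complex.I * k * (1 : ℝ) : ℂ) = k * (2 * Real.pi * Complex.I) by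
      push_cast; ring, h1]
    simp

/-- Periodization of an integrable function. -/
theorem integrableOn_tsum_comp_add_int {H : ℝ → ℂ} (hH : Integrable H) :
    IntegrableOn (fun x => ∑' j : ℤ, H (x + j)) (Set.Ioc 0 1) ∧
      ∫ x in Set.Ioc (0 : ℝ) 1, ∑' j : ℤ, H (x + j) = ∫ x, H x := by
  have hj : ∀ j : ℤ, Integrable fun x : ℝ => H (x + j) := fun j => hH.comp_add_right (j : ℝ)
  -- Summability of the `L¹` norms over unit intervals permits exchanging sum and integral; it also
  -- gives integrability of the periodization.
  have hn := hH.norm.hasSum_intervalIntegral_comp_add_int.summable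
  simp_rw [intervalIntegral.integral_of_le (zero_le_one' ℝ)] at hn
  have hs := hasSum_integral_of_summable_integral_norm (μ := volume.restrict (Set.Ioc (0 : ℝ) 1))
    (F := fun (j : ℤ) x => H (x + j)) (fun j => (hj j).integrableOn) hn
  have hs2 := hH.hasSum_intervalIntegral_comp_add_int
  simp_rw [intervalIntegral.integral_of_le (zero_le_one' ℝ)] at hs2
  refine ⟨⟨(AEMeasurable.tsum fun j =>
    (hj j).aestronglyMeasurable.aemeasurable.restrict).aestronglyMeasurable, ?_⟩, hs.unique hs2⟩
  refine lt_of_le_of_lt (lintegral_mono fun x => enorm_tsum_le_tsum_enorm) ?_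
  rw [lintegral_tsum fun j => (hj j).aestronglyMeasurable.enorm.restrict]
  have e : ∀ j : ℤ, ∫⁻ x in Set.Ioc (0 : ℝ) 1, ‖H (x + j)‖ₑ =
      ENNReal.ofReal (∫ x in Set.Ioc (0 : ℝ) 1, ‖H (x + j)‖) := fun j => by
    rw [ofReal_integral_norm_eq_lintegral_enorm (hj j).integrableOn]
  simp_rw [e]
  rw [← ENNReal.ofReal_tsum_of_nonneg (fun j => integral_nonneg fun x => norm_nonneg _) hn]
  exact ENNReal.ofReal_lt_top

end FourierSeries

/-! ### Fourier coefficients of the bracket and orthonormality -/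

section Main

variable {d : ℕ}

theorem hsInner_smul_left {E : Type*} [NormedAddCommGroup E] [InnerProductSpace ℂ E]
    [CompleteSpace E] (c : ℂ) (S T : E →L[ℂ] E) : hsInner (c • S) T = c * hsInner S T := by
  simp [hsInner, opTrace, tsum_mul_left]

theorem leftTranslate_mul (g h : Heis d) (φ : L2H d) :
    leftTranslate (g * h) φ = leftTranslate g (leftTranslate h φ) := by
  refine Lp.ext ?_
  filter_upwards [coeFn_leftTranslate (g * h) φ, coeFn_leftTranslate g (leftTranslate h φ),
    (Heis.measurePreserving_mul_left g⁻¹).quasiMeasurePreserving.ae (coeFn_leftTranslate h φ)]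
    with x h1 h2 h3
  rw [h1, h2, h3, mul_inv_rev, mul_assoc]

theorem leftTranslate_one (φ : L2H d) : leftTranslate 1 φ = φ := by
  refine Lp.ext ?_
  filter_upwards [coeFn_leftTranslate 1 φ] with x h1
  rw [h1, inv_one, one_mul]

/-- The Fourier coefficients of the bracket. -/
theorem integral_bracket_mul_exp (φ χ : L2H d) (k : ℤ) :
    IntegrableOn (bracket φ χ) (Set.Ioc 0 1) ∧
      ∫ α in Set.Ioc (0 : ℝ) 1,
        bracket φ χ α * Complex.exp (2 * Real.pi * Complex.I * α * k) =
      inner ℂ χ (leftTranslate (Heis.mk 0 0 (k : ℝ)) φ) := by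
  have hF := isGroupFourier_groupFourier φ
  have hG := isGroupFourier_groupFourier χ
  refine ⟨(integrableOn_tsum_comp_add_int (hF.integral_hsInner hG).1).1, ?_⟩
  -- The polarized identity holds for any representative, so the explicit field `e^{2πilk} ℱφ(l)`
  -- can stand for the transform of the translate.
  obtain ⟨hi, he⟩ := (hF.leftTranslate_central k).integral_hsInner hG
  rw [← he, ← (integrableOn_tsum_comp_add_int hi).2]
  congr 1
  ext α
  rw [bracket, ← tsum_mul_right]
  refine tsum_congr fun j => ?_
  -- Since `j * k` is an integer, the exponential does not depend on `j` and leaves the sum.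
  have e : Complex.exp (2 * Real.pi * Complex.I * ((α + j : ℝ) : ℂ) * ((k : ℝ) : ℂ)) =
      Complex.exp (2 * Real.pi * Complex.I * α * k) := by
    rw [show (2 * Real.pi * Complex.I * ((α + j : ℝ) : ℂ) * ((k : ℝ) : ℂ) : ℂ) =
      2 * Real.pi * Complex.I * α * k + (j * k : ℤ) * (2 * Real.pi * Complex.I) by
        push_cast; ring, Complex.exp_add, Complex.exp_int_mul_two_pi_mul_I, mul_one]
  rw [hsInner_smul_left, e]
  ring

/-- The bracket is a.e. equal to the constant `c` exactly when its Fourier coefficients are those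
of `c`. -/
theorem bracket_ae_eq_const_iff (φ χ : L2H d) (c : ℂ) :
    (∀ᵐ α ∂(volume.restrict (Set.Ioc (0 : ℝ) 1)), bracket φ χ α = c) ↔
      ∀ k : ℤ, inner ℂ χ (leftTranslate (Heis.mk 0 0 (k : ℝ)) φ) = if k = 0 then c else 0 := by
  have hc : ∀ k : ℤ, ∫ α in Set.Ioc (0 : ℝ) 1, c * Complex.exp (2 * Real.pi * Complex.I * α * k) =
      if k = 0 then c else 0 := fun k => by
    rw [integral_const_mul, integral_Ioc_exp_two_pi]
    split_ifs <;> simp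
  constructor
  · intro h k
    rw [← (integral_bracket_mul_exp φ χ k).2, ← hc k]
    refine integral_congr_ae ?_
    filter_upwards [h] with α hα
    rw [hα]
  · intro h
    have hb : IntegrableOn (bracket φ χ) (Set.Ioc 0 1) := (integral_bracket_mul_exp φ χ 0).1
    have hexp : ∀ (f : ℝ → ℂ) (k : ℤ), IntegrableOn f (Set.Ioc 0 1) →
        IntegrableOn (fun α => f α * Complex.exp (2 * Real.pi * Complex.I * α * k))
          (Set.Ioc 0 1) := fun f k hf =>
      Integrable.mul_bdd (c := 1) hf (by fun_prop : Continuous fun α : ℝ =>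
        Complex.exp (2 * Real.pi * Complex.I * α * k)).aestronglyMeasurable
        (Eventually.of_forall fun x => by simp [Complex.norm_exp])
    have hcI : IntegrableOn (fun _ : ℝ => c) (Set.Ioc 0 1) := integrableOn_const (by simp)
    have := ae_eq_zero_of_forall_integral_mul_exp_eq_zero (f := fun α => bracket φ χ α - c)
      (hb.sub hcI) fun k => by
        simp only [sub_mul]
        rw [integral_sub (hexp _ k hb) (hexp _ k hcI), hc k, (integral_bracket_mul_exp φ χ k).2,
          h k, sub_self]
    filter_upwards [this] with α hα
    exact sub_eq_zero.1 hα

/-- A family is an orthonormal basis of its closed linear span if and only if it is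
orthonormal. -/
theorem exists_hilbertBasis_cyclicSpan_iff (Γ : Subgroup (Heis d)) (ψ : L2H d) :
    (∃ b : HilbertBasis Γ ℂ (cyclicSpan Γ ψ), ∀ γ : Γ, (b γ : L2H d) = leftTranslate γ ψ) ↔
      Orthonormal ℂ fun γ : Γ => leftTranslate (γ : Heis d) ψ := by
  constructor
  · rintro ⟨b, hb⟩
    have := b.orthonormal.comp_linearIsometry (cyclicSpan Γ ψ).subtypeₗᵢ
    convert this using 1
    ext1 γ
    exact (hb γ).symm
  · intro ho
    let v : Γ → cyclicSpan Γ ψ := fun γ => ⟨leftTranslate (γ : Heis d) ψ,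
      Submodule.le_topologicalClosure _ (Submodule.subset_span ⟨γ, rfl⟩)⟩
    have hv : Orthonormal ℂ v := by
      rw [← (cyclicSpan Γ ψ).subtypeₗᵢ.orthonormal_comp_iff]
      exact ho
    have : CompleteSpace (cyclicSpan Γ ψ) :=
      (Submodule.isClosed_topologicalClosure _).completeSpace_coe
    refine ⟨HilbertBasis.mk hv ?_, fun γ => by rw [HilbertBasis.coe_mk]⟩
    rintro ⟨x, hx⟩ -
    -- Density inside the subspace is read off in the ambient space, where the closure is
    -- `cyclicSpan` by definition.
    rw [← SetLike.mem_coe, Submodule.topologicalClosure_coe, closure_subtype]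
    have : Submodule.span ℂ (Set.range fun γ : Γ => leftTranslate (γ : Heis d) ψ) =
        (Submodule.span ℂ (Set.range v)).map (cyclicSpan Γ ψ).subtype := by
      rw [Submodule.map_span, ← Set.range_comp]
      rfl
    have hx' := hx
    rw [cyclicSpan, this, ← SetLike.mem_coe, Submodule.topologicalClosure_coe,
      Submodule.map_coe] at hx'
    exact hx'

open Classical in
-- Applying the isometry `L_{δ⁻¹}` shows that the Gram entry at `(γ, δ)` depends only on `δ⁻¹ γ`.
theorem orthonormal_leftTranslate_iff (Γ : Subgroup (Heis d)) (ψ : L2H d) :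
    (Orthonormal ℂ fun γ : Γ => leftTranslate (γ : Heis d) ψ) ↔
      ∀ γ ∈ Γ, inner ℂ (leftTranslate γ ψ) ψ = if γ = 1 then (1 : ℂ) else 0 := by
  rw [orthonormal_iff_ite]
  constructor
  · intro h γ hγ
    have := h ⟨γ, hγ⟩ 1
    simpa [leftTranslate_one, Subtype.ext_iff] using this
  · rintro h ⟨γ, hγ⟩ ⟨δ, hδ⟩
    have e : γ = δ * (δ⁻¹ * γ) := by group
    have := h (δ⁻¹ * γ) (Γ.mul_mem (Γ.inv_mem hδ) hγ)
    rw [← (leftTranslate δ).inner_map_map, ← leftTranslate_mul, ← e] at this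
    simp only [this, inv_mul_eq_one, Subtype.mk.injEq, eq_comm]

end Main
end

open Classical in
theorem theorem1p1 (d : ℕ) (A B : GL (Fin d) ℝ) (hAB : IsIntegralPair A B)
    (ψ : L2H d) (hψ : ψ ≠ 0) :
    (∃ b : HilbertBasis (heisLattice A B hAB) ℂ (cyclicSpan (heisLattice A B hAB) ψ),
        ∀ γ : heisLattice A B hAB, (b γ : L2H d) = leftTranslate (γ : Heis d) ψ) ↔
      ∀ γ₁ ∈ heisLattice₁ A B, ∀ᵐ α ∂(volume.restrict (Set.Ioc (0 : ℝ) 1)),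
        bracket ψ (leftTranslate γ₁ ψ) α = if γ₁ = 1 then 1 else 0 := by
  rw [exists_hilbertBasis_cyclicSpan_iff, orthonormal_leftTranslate_iff]
  simp_rw [bracket_ae_eq_const_iff]
  have hinv : ∀ k : ℝ, (Heis.mk 0 0 k : Heis d) * Heis.mk 0 0 (-k) = 1 := fun k => by
    ext1 <;> simp
  -- The central translation moves to the other slot of the inner product with opposite sign, so the
  -- Fourier coefficients are indexed by the products `(0,0,-k) γ₁`.
  have key : ∀ (k : ℝ) (γ : Heis d), inner ℂ (leftTranslate γ ψ)
      (leftTranslate (Heis.mk 0 0 k) ψ) =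
        (inner ℂ (leftTranslate (Heis.mk 0 0 (-k) * γ) ψ) ψ : ℂ) := fun k γ => by
    rw [← (leftTranslate (Heis.mk 0 0 k)).inner_map_map (leftTranslate (Heis.mk 0 0 (-k) * γ) ψ),
      ← leftTranslate_mul, ← mul_assoc, hinv, one_mul]
  constructor
  · rintro h _ ⟨m, n, rfl⟩ k
    rw [key, h _ ⟨⟨m, by simp⟩, ⟨n, by simp⟩, ⟨-k, by simp⟩⟩, ← ite_and]
    congr 1
    simp only [Heis.ext_iff, Heis.p_mul, Heis.q_mul, Heis.t_mul, Heis.p_mk, Heis.q_mk, Heis.t_mk,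
      Heis.p_one, Heis.q_one, Heis.t_one, zero_add, inner_zero_left, add_zero, neg_eq_zero,
      Int.cast_eq_zero, eq_iff_iff]
    tauto
  · rintro h γ ⟨⟨m, hm⟩, ⟨n, hn⟩, ⟨k, hk⟩⟩
    -- The coefficient of index `-k` compensates the sign in `key`. The left factor has `p = 0`, so
    -- its product with the `Γ₁` part acquires no cocycle term and equals `γ`.
    have h1 := h _ ⟨m, n, rfl⟩ (-k)
    have e : γ = Heis.mk 0 0 (-((-k : ℤ) : ℝ)) * Heis.mk (latticeVec A m) (latticeVec B n) 0 := by
      ext1 <;> simp [hm, hn, hk]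
    rw [key, ← e, ← ite_and] at h1
    rw [h1]
    congr 1
    simp only [Heis.ext_iff, hm, hn, hk, Heis.p_mk, Heis.q_mk, Heis.t_mk,
      Heis.p_one, Heis.q_one, Heis.t_one, neg_eq_zero, Int.cast_eq_zero, eq_iff_iff]
    tauto
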